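/- **Extension Theorem.** Let $\mathbb K$ be a structure, in a language $L$ extending the language of rings, that expands a field of characteristic $0$; let $T$ be its complete $L$-theory and $F=\mathrm{dcl}(\emptyset)\subseteq\mathbb K$. Assume that $T$ is model complete and that $\mathbb K$ is algebraically bounded over $F$: for every $M\models T$ and every $A\subseteq M$, the model-theoretic algebraic closure $\mathrm{acl}(A)$ (the union of the finite $A$-definable subsets of $M$) is the set of elements of $M$ that are algebraic over the subfield generated by $\mathrm{dcl}_M(\emptyset)\cup A$. Let $\eta_1,\dots,\eta_k$ be derivations on $F$ and let $L^{\bar\delta}=L\cup\{\delta_1,\dots,\delta_k\}$ with $\delta_i$ new unary function symbols. Let $T^{\bar\delta,?}$ be either of the following two $L^{\bar\delta}$-theories: the expansion of $T$ saying that each $\delta_i$ is a derivation extending $\eta_i$; or the same theory together with the axioms that the $\delta_i$ commute with each other. Let $T^{\bar\delta,?}_g$ be the model completion of $T^{\bar\delta,?}$ and let $\langle\mathfrak C,\bar\delta\rangle$ be a monster model of $T^{\bar\delta,?}_g$, i.e. a $\kappa$-saturated model, where $\kappa>\aleph_0+|L|$; "small" means of cardinality less than $\kappa$. (No homogeneity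 beyond what $\kappa$-saturation gives is needed.) Let $\Gamma$ be the free monoid generated by $\delta_1,\dots,\delta_k$ (the free commutative monoid in the commuting case), let $n\in\mathbb N$, and let $\Gamma_n=\{\gamma x_i:\gamma\in\Gamma,\ i\le n\}$. For $J\subseteq\Gamma_n$ and $\bar a\in\mathfrak C^n$ put $\mathrm{Jet}_J(\bar a)=(f(\bar a))_{f\in J}$. For a complete $L^{\bar\delta}$-type $s(\bar x)$ in $n$ variables over a set $C\subseteq\mathfrak C$, let $s_J$ be the set of $L(C)$-formulas $\alpha$ in variables indexed by $J$ such that the formula $\alpha(\mathrm{Jet}_J(\bar x))$ belongs to $s$. A complete $L$-type $q$ over $C$ in variables indexed by $J$ is *$\bar\delta$-compatible* if $q=s_J$ for some complete $L^{\bar\delta}$-type $s$ over $C$ in $n$ variables. For subsets $X,C,B$ of $\mathfrak C$, write $X\perp^M_C B$ if every finite subset of $X$ that is independent over $C$ with respect to $\mathrm{acl}$ (the $L$-algebraic closure) remains $\mathrm{acl}$-independent over $C\cup B$. For a complete $L$-type $q$ over $B$, write $q\perp^M_A B$ if some realization $\bar c$ of $q$ in $\mathfrak C$ satisfies $\bar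 c\perp^M_A B$. Let $A\subseteq B$ be small subsets of $\mathfrak C$ with $\bar\delta A\subseteq A$ and $\bar\delta B\subseteq B$. Let $p$ be a complete $L^{\bar\delta}$-type over $A$ in $n$ variables, let $J\subseteq\Gamma_n$, and let $q$ be a complete $L$-type over $B$, in variables indexed by $J$, extending $p_J$. If $q\perp^M_A B$, then $q$ is $\bar\delta$-compatible, and $q$ is realized by $\mathrm{Jet}_J(\bar c)$ for some $\bar c\in\mathfrak C^n$. -/

import Mathlib

open FirstOrder FirstOrder.Language Cardinal

universe u

namespace GenericDerivations

/-! ### Model-theoretic closures -/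

/-- The model-theoretic definable closure of `A` in the `L`-structure `M`. -/
def dcl (L : FirstOrder.Language.{u, u}) {M : Type u} [L.Structure M] (A : Set M) : Set M :=
  {x | A.Definable₁ L {x}}

/-- The model-theoretic algebraic closure of `A` in the `L`-structure `M`: the union of the
finite `A`-definable subsets of `M`. -/
def acl (L : FirstOrder.Language.{u, u}) {M : Type u} [L.Structure M] (A : Set M) : Set M :=
  {x | ∃ s : Set M, A.Definable₁ L s ∧ s.Finite ∧ x ∈ s}

/-- The set `S` is independent over `C` with respect to the closure operator `acl`. -/
def AclIndependent (L : FirstOrder.Language.{u, u}) {M : Type u} [L.Structure M] (C S : Set M) : Prop :=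
  ∀ x ∈ S, x ∉ acl L (C ∪ (S \ {x}))

/-- The relation "`X` is M-independent from `B` over `C`": every finite subset of `X` that is
algebraically independent over `C` remains algebraically independent over `C ∪ B`. -/
def MIndependent (L : FirstOrder.Language.{u, u}) {M : Type u} [L.Structure M] (X C B : Set M) : Prop :=
  ∀ S : Set M, S ⊆ X → S.Finite → AclIndependent L C S → AclIndependent L (C ∪ B) S

section Dcl

variable {L : FirstOrder.Language.{u, u}} {M : Type u} [L.Structure M]

theorem definableFun_const_of_mem_dcl {c : M} (hc : c ∈ dcl L (∅ : Set M)) (γ : Type) :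
    (∅ : Set M).DefinableFun L (fun _ : γ → M => c) := by
  have h : (∅ : Set M).Definable L {v : Fin 1 → M | v 0 ∈ ({c} : Set M)} := hc
  have h2 := h.preimage_comp (fun _ : Fin 1 => (none : Option γ))
  have he : (fun _ : γ → M => c).tupleGraph =
      (fun g : Option γ → M => g ∘ fun _ : Fin 1 => (none : Option γ)) ⁻¹'
        {v : Fin 1 → M | v 0 ∈ ({c} : Set M)} := by
    ext w
    simp [Function.tupleGraph, eq_comm]
  rw [Set.DefinableFun, he]
  exact h2

theorem mem_dcl_of_definableFun_const {c : M}
    (hc : (∅ : Set M).DefinableFun L (fun _ : Fin 1 → M => c)) : c ∈ dcl L (∅ : Set M) := by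
  have h := Set.DefinableFun.ofPred_eq (Set.DefinableFun.proj (M := M) L (i := (0 : Fin 1))) hc
  exact h

theorem apply_mem_dcl {m : ℕ} {g : (Fin m → M) → M} (hg : (∅ : Set M).DefinableFun L g)
    {c : Fin m → M} (hc : ∀ i, c i ∈ dcl L (∅ : Set M)) : g c ∈ dcl L (∅ : Set M) := by
  apply mem_dcl_of_definableFun_const
  exact Set.DefinableFun.comp (g := fun _ => c)
    (fun i => definableFun_const_of_mem_dcl (hc i) (Fin 1)) hg

end Dcl

section Field

variable {L : FirstOrder.Language.{u, u}} (ι : FirstOrder.Language.ring →ᴸ L) (K : Type u) [Field K]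
  [FirstOrder.Ring.CompatibleRing K] [L.Structure K] [ι.IsExpansionOn K]

/-- `dcl(∅)` is a subfield of any structure that expands a field. -/
def dclEmpty : Subfield K :=
  have hadd : (∅ : Set K).DefinableFun L (fun v : Fin 2 → K => v 0 + v 1) := by
    have h := Set.DefinableFun.fun_symbol (M := K) (ι.onFunction FirstOrder.Ring.addFunc)
    convert h using 2 with v
    rw [LHom.map_onFunction, FirstOrder.Ring.CompatibleRing.funMap_add]
  have hmul : (∅ : Set K).DefinableFun L (fun v : Fin 2 → K => v 0 * v 1) := by
    have h := Set.DefinableFun.fun_symbol (M := K) (ι.onFunction FirstOrder.Ring.mulFunc)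
    convert h using 2 with v
    rw [LHom.map_onFunction, FirstOrder.Ring.CompatibleRing.funMap_mul]
  have hneg : (∅ : Set K).DefinableFun L (fun v : Fin 1 → K => - v 0) := by
    have h := Set.DefinableFun.fun_symbol (M := K) (ι.onFunction FirstOrder.Ring.negFunc)
    convert h using 2 with v
    rw [LHom.map_onFunction, FirstOrder.Ring.CompatibleRing.funMap_neg]
  have hzero : (∅ : Set K).DefinableFun L (fun _ : Fin 0 → K => 0) := by
    have h := Set.DefinableFun.fun_symbol (M := K) (ι.onFunction FirstOrder.Ring.zeroFunc)
    convert h using 2 with v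
    rw [LHom.map_onFunction]
    exact (FirstOrder.Ring.CompatibleRing.funMap_zero v).symm
  have hone : (∅ : Set K).DefinableFun L (fun _ : Fin 0 → K => 1) := by
    have h := Set.DefinableFun.fun_symbol (M := K) (ι.onFunction FirstOrder.Ring.oneFunc)
    convert h using 2 with v
    rw [LHom.map_onFunction]
    exact (FirstOrder.Ring.CompatibleRing.funMap_one v).symm
  have h0 : (0 : K) ∈ dcl L (∅ : Set K) := apply_mem_dcl hzero (c := ![]) (fun i => i.elim0)
  have h1 : (1 : K) ∈ dcl L (∅ : Set K) := apply_mem_dcl hone (c := ![]) (fun i => i.elim0)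
  { carrier := dcl L (∅ : Set K)
    zero_mem' := h0
    one_mem' := h1
    add_mem' := fun {a b} ha hb =>
      apply_mem_dcl hadd (c := ![a, b]) (Fin.forall_fin_two.2 ⟨ha, hb⟩)
    mul_mem' := fun {a b} ha hb =>
      apply_mem_dcl hmul (c := ![a, b]) (Fin.forall_fin_two.2 ⟨ha, hb⟩)
    neg_mem' := fun {a} ha => apply_mem_dcl hneg (c := ![a]) (Fin.forall_fin_one.2 ha)
    inv_mem' := fun a ha => by
      by_cases h : a = 0
      · subst h
        rw [inv_zero]
        exact h0
      · have hm : (∅ : Set K).DefinableFun L (fun v : Fin 1 → K => a * v 0) :=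
          Set.DefinableFun.comp (g := fun v : Fin 1 → K => ![a, v 0])
            (Fin.forall_fin_two.2 ⟨definableFun_const_of_mem_dcl ha (Fin 1),
              Set.DefinableFun.proj L⟩) hmul
        have hs := hm.ofPred_eq (definableFun_const_of_mem_dcl h1 (Fin 1))
        have he : {v : Fin 1 → K | a * v 0 = 1} = {v : Fin 1 → K | v 0 ∈ ({a⁻¹} : Set K)} := by
          ext v
          simp only [Set.mem_ofPred_eq, Set.mem_singleton_iff]
          exact mul_eq_one_iff_inv_eq₀ h |>.trans eq_comm
        rw [he] at hs
        exact hs }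

/-- The structure `K` is algebraically bounded (over `F = dcl(∅)`): in every structure `M`
elementarily equivalent to `K`, the model-theoretic algebraic closure of a set `A` consists of
the elements that are algebraic over the subfield generated by `dcl(∅) ∪ A`. -/
def IsAlgebraicallyBounded : Prop :=
  ∀ (M : Type u) [Field M] [FirstOrder.Ring.CompatibleRing M] [L.Structure M]
    [ι.IsExpansionOn M] [M ⊨ L.completeTheory K] (A : Set M) (x : M),
    x ∈ acl L A ↔ IsAlgebraic (Subfield.closure (dcl L (∅ : Set M) ∪ A)) x

end Field

/-! ### Model completeness, model completions, complete types, saturation -/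

section ModelTheory

variable {L : FirstOrder.Language.{u, u}}

/-- The theory `T` is model complete: embeddings between models of `T` are elementary. -/
def IsModelComplete (T : L.Theory) : Prop :=
  ∀ (M N : Type u) [L.Structure M] [L.Structure N] [M ⊨ T] [N ⊨ T] (f : M ↪[L] N)
    (n : ℕ) (φ : L.Formula (Fin n)) (v : Fin n → M), φ.Realize (f ∘ v) ↔ φ.Realize v

/-- The theory `T'` is a model completion of the theory `T` (in the same language):
every model of `T'` is a model of `T`, every model of `T` embeds into a model of `T'`, and
`T'` together with the diagram of a model of `T` is complete. Any two model completions of `T`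
have the same models. -/
structure IsModelCompletion (T T' : L.Theory) : Prop where
  model_of_model : ∀ (M : Type u) [L.Structure M] [M ⊨ T'], M ⊨ T
  exists_embedding : ∀ (M : Type u) [L.Structure M] [M ⊨ T],
    ∃ (N : Type u) (_ : L.Structure N), N ⊨ T' ∧ Nonempty (M ↪[L] N)
  realize_iff : ∀ (M N₁ N₂ : Type u) [L.Structure M] [L.Structure N₁] [L.Structure N₂]
    [M ⊨ T] [N₁ ⊨ T'] [N₂ ⊨ T'] (f₁ : M ↪[L] N₁) (f₂ : M ↪[L] N₂)
    (n : ℕ) (φ : L.Formula (Fin n)) (v : Fin n → M),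
    φ.Realize (f₁ ∘ v) ↔ φ.Realize (f₂ ∘ v)

/-- `S_α(A)`: the complete `L`-types over the subset `A` of the structure `M`, in variables
indexed by `α`. -/
abbrev TypesOver (L : FirstOrder.Language.{u, u}) {M : Type u} [L.Structure M] (A : Set M)
    (α : Type) :=
  ((L[[A]]).completeTheory M).CompleteType α

/-- The `L(A)`-formulas that belong to a complete type over `A`. -/
def TypesOver.formulas {M : Type u} [L.Structure M] {A : Set M} {α : Type}
    (p : TypesOver L A α) : Set (L[[A]].Formula α) :=
  {φ | Formula.equivSentence φ ∈ p}

/-- The tuple `c` realizes the complete type `p`. -/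
def TypesOver.IsRealizedBy {M : Type u} [L.Structure M] {A : Set M} {α : Type}
    (p : TypesOver L A α) (c : α → M) : Prop :=
  ∀ φ ∈ p.formulas, φ.Realize c

/-- The structure `M` is `κ`-saturated: it realizes every complete type in finitely many
variables over every subset of cardinality less than `κ`. -/
def IsSaturated (L : FirstOrder.Language.{u, u}) (M : Type u) [L.Structure M]
    (κ : Cardinal.{u}) : Prop :=
  ∀ A : Set M, #A < κ → ∀ (n : ℕ) (p : TypesOver L A (Fin n)), ∃ c, p.IsRealizedBy c

/-- The `L`-type `q`, in variables `α`, is M-independent from `B` over `A`: some realization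
of `q` is. -/
def TypesOver.MIndependent {M : Type u} [L.Structure M] {B : Set M} {α : Type}
    (q : TypesOver L B α) (A : Set M) : Prop :=
  ∃ c : α → M, q.IsRealizedBy c ∧ GenericDerivations.MIndependent L (Set.range c) A B

/-- The universal closure of a formula in finitely many variables. -/
noncomputable def univClosure {n : ℕ} (φ : L.Formula (Fin n)) : L.Sentence :=
  Formula.iAlls (Fin n) (φ.relabel (Sum.inr : Fin n → Empty ⊕ Fin n))

end ModelTheory

/-! ### The language and the theory of structures with `k` derivations -/

/-- The function symbols `δ₁, …, δ_k`, all unary. -/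
inductive DerivFunc (k : ℕ) : ℕ → Type
  | delta (i : Fin k) : DerivFunc k 1

/-- The language `{δ₁, …, δ_k}`. -/
def derivLanguage (k : ℕ) : FirstOrder.Language.{0, 0} :=
  ⟨DerivFunc k, fun _ => Empty⟩

/-- The language `L^δ`: `L` together with the function symbols `δ₁, …, δ_k`. -/
abbrev withDeriv (L : FirstOrder.Language.{u, u}) (k : ℕ) : FirstOrder.Language.{u, u} :=
  L.sum (derivLanguage k)

/-- The function symbol `δᵢ`. -/
def deltaSymb (L : FirstOrder.Language.{u, u}) {k : ℕ} (i : Fin k) : (withDeriv L k).Functions 1 :=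
  Sum.inr (DerivFunc.delta i)

/-- Whether the derivations are required to commute. -/
inductive DerivMode
  | commuting
  | noncommuting

section Theory

variable {L : FirstOrder.Language.{u, u}} {k : ℕ}

/-- The term `δᵢ t`. -/
def deltaTerm {α : Type*} (i : Fin k) (t : (withDeriv L k).Term α) : (withDeriv L k).Term α :=
  (deltaSymb L i).apply₁ t

/-- The term `s + t` of `L^δ`, with the addition symbol supplied by `ι`. -/
def addTerm (ι : FirstOrder.Language.ring →ᴸ L) {α : Type*} (s t : (withDeriv L k).Term α) :
    (withDeriv L k).Term α :=
  Functions.apply₂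
    ((LHom.sumInl : L →ᴸ withDeriv L k).onFunction (ι.onFunction FirstOrder.Ring.addFunc)) s t

/-- The term `s * t` of `L^δ`, with the multiplication symbol supplied by `ι`. -/
def mulTerm (ι : FirstOrder.Language.ring →ᴸ L) {α : Type*} (s t : (withDeriv L k).Term α) :
    (withDeriv L k).Term α :=
  Functions.apply₂
    ((LHom.sumInl : L →ᴸ withDeriv L k).onFunction (ι.onFunction FirstOrder.Ring.mulFunc)) s t

/-- The axiom `∀ x y, δᵢ (x + y) = δᵢ x + δᵢ y`. -/
noncomputable def additiveAxiom (ι : FirstOrder.Language.ring →ᴸ L) (i : Fin k) :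
    (withDeriv L k).Sentence :=
  let x : (withDeriv L k).Term (Fin 2) := Term.var 0
  let y : (withDeriv L k).Term (Fin 2) := Term.var 1
  univClosure ((deltaTerm i (addTerm ι x y)).equal (addTerm ι (deltaTerm i x) (deltaTerm i y)))

/-- The axiom `∀ x y, δᵢ (x * y) = x * δᵢ y + y * δᵢ x`. -/
noncomputable def leibnizAxiom (ι : FirstOrder.Language.ring →ᴸ L) (i : Fin k) :
    (withDeriv L k).Sentence :=
  let x : (withDeriv L k).Term (Fin 2) := Term.var 0
  let y : (withDeriv L k).Term (Fin 2) := Term.var 1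
  univClosure ((deltaTerm i (mulTerm ι x y)).equal
    (addTerm ι (mulTerm ι x (deltaTerm i y)) (mulTerm ι y (deltaTerm i x))))

/-- The axiom `∀ x, δᵢ (δⱼ x) = δⱼ (δᵢ x)`. -/
noncomputable def commuteAxiom (L : FirstOrder.Language.{u, u}) (i j : Fin k) :
    (withDeriv L k).Sentence :=
  let x : (withDeriv L k).Term (Fin 1) := Term.var 0
  univClosure ((deltaTerm i (deltaTerm j x)).equal (deltaTerm j (deltaTerm i x)))

/-- The axiom `∀ x, φ(x) → ψ(δᵢ x)`. If `φ` defines the element `c` of `dcl(∅)`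
and `ψ` defines `d`, then it says that `δᵢ c = d`. -/
noncomputable def valueAxiom (i : Fin k) (φ ψ : L.Formula (Fin 1)) : (withDeriv L k).Sentence :=
  univClosure (((LHom.sumInl : L →ᴸ withDeriv L k).onFormula φ).imp
    (BoundedFormula.subst ((LHom.sumInl : L →ᴸ withDeriv L k).onFormula ψ)
      (fun _ => deltaTerm i (Term.var 0))))

/-- The formula `φ(x)` defines the element `c` of `K`. -/
def Defines {K : Type u} [L.Structure K] (φ : L.Formula (Fin 1)) (c : K) : Prop :=
  ∀ x : K, φ.Realize (fun _ => x) ↔ x = c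

/-- The `L^δ`-theory of derivations on models of the complete theory `T` of `K`: the expansion
of `T` saying that `δ₁, …, δ_k` are derivations, that they commute in case
`mode` is `commuting`, and that `δᵢ` extends the given derivation `ηᵢ` of `F = dcl(∅)`. -/
def derivTheory (mode : DerivMode) (ι : FirstOrder.Language.ring →ᴸ L) (K : Type u) [Field K]
    [FirstOrder.Ring.CompatibleRing K] [L.Structure K] [ι.IsExpansionOn K]
    (η : Fin k → Derivation ℤ (dclEmpty ι K) (dclEmpty ι K)) : (withDeriv L k).Theory :=
  (LHom.sumInl : L →ᴸ withDeriv L k).onTheory (L.completeTheory K) ∪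
    {σ | ∃ i : Fin k, σ = additiveAxiom ι i} ∪
    {σ | ∃ i : Fin k, σ = leibnizAxiom ι i} ∪
    {σ | ∃ (i : Fin k) (c : dclEmpty ι K) (φ ψ : L.Formula (Fin 1)),
      Defines φ (c : K) ∧ Defines ψ (η i c : K) ∧ σ = valueAxiom i φ ψ} ∪
    {σ | mode = DerivMode.commuting ∧ ∃ i j : Fin k, σ = commuteAxiom L i j}

end Theory

/-! ### Jets -/

/-- The monoid `Γ` generated by `δ₁, …, δ_k`: the free commutative monoid `ℕᵏ` if the
derivations commute, the free monoid of words otherwise. -/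
def Gam : DerivMode → ℕ → Type
  | DerivMode.commuting, k => Fin k → ℕ
  | DerivMode.noncommuting, k => FreeMonoid (Fin k)

/-- The word in `δ₁, …, δ_k` given by an element of `Γ`;
`m ∈ ℕᵏ` is written as `δ₁^{m₁} ⋯ δ_k^{m_k}`. -/
def Gam.word : {mode : DerivMode} → {k : ℕ} → Gam mode k → List (Fin k)
  | DerivMode.commuting, k, m => (List.finRange k).flatMap fun i => List.replicate (m i) i
  | DerivMode.noncommuting, _, w => FreeMonoid.toList w

section Jets

variable {L : FirstOrder.Language.{u, u}} {k n : ℕ} {mode : DerivMode}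

/-- The `L^δ`-term `γ xⱼ` in `x = (x₁, …, x_n)`, for `γ ∈ Γ` and `j ≤ n`.
The pairs `(γ, j)` index `Γ_n`. -/
def jetTerm (L : FirstOrder.Language.{u, u}) (f : Gam mode k × Fin n) :
    (withDeriv L k).Term (Fin n) :=
  f.1.word.foldr deltaTerm (Term.var f.2)

/-- The jet of the tuple `a` with indices in `J ⊆ Γ_n`. -/
def jet {M : Type u} [(withDeriv L k).Structure M] (J : Set (Gam mode k × Fin n))
    (a : Fin n → M) : J → M :=
  fun f => (jetTerm L f.1).realize a

/-- For an `L(A)`-formula `φ` in variables indexed by `J ⊆ Γ_n`, the `L^δ(A)`-formula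
`φ(Jet(x))` in `x = (x₁, …, x_n)`, where each variable is replaced with the corresponding
term. -/
def jetFormula {A : Type u} {J : Set (Gam mode k × Fin n)} (φ : L[[A]].Formula J) :
    (withDeriv L k)[[A]].Formula (Fin n) :=
  BoundedFormula.subst (((LHom.sumInl : L →ᴸ withDeriv L k).addConstants A).onFormula φ)
    (fun f => ((withDeriv L k).lhomWithConstants A).onTerm (jetTerm L f.1))

variable {M : Type u} [L.Structure M] [(derivLanguage k).Structure M]

/-- The `L`-type `p_J`, as a set of `L(A)`-formulas in variables `J`: the formulas `φ` such
that `φ(Jet(x))` belongs to the `L^δ`-type `p`. -/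
def jetType {A : Set M} (p : TypesOver (withDeriv L k) A (Fin n))
    (J : Set (Gam mode k × Fin n)) : Set (L[[A]].Formula J) :=
  {φ | jetFormula φ ∈ p.formulas}

/-- The `L`-type `q` over `B` is `δ`-compatible: `q = s_J` for some complete
`L^δ`-type `s` over `B` in `n` variables. -/
def IsDeltaCompatible {B : Set M} {J : Set (Gam mode k × Fin n)} (q : TypesOver L B J) : Prop :=
  ∃ s : TypesOver (withDeriv L k) B (Fin n), q.formulas = jetType s J

/-- The `L`-type `q` over `B` extends the set `r` of formulas over the subset `A` of `B`. -/
def Extends {A B : Set M} (hAB : A ⊆ B) {α : Type} (q : TypesOver L B α)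
    (r : Set (L[[A]].Formula α)) : Prop :=
  ∀ φ ∈ r, (L.lhomWithConstantsMap (Set.inclusion hAB)).onFormula φ ∈ q.formulas

variable (L k) in
/-- The set `A` is closed under `δ₁, …, δ_k`. -/
def DeltaClosed (A : Set M) : Prop :=
  ∀ (i : Fin k), ∀ a ∈ A, (Structure.funMap (deltaSymb L i) ![a] : M) ∈ A

end Jets

end GenericDerivations

open GenericDerivations

/-!
Let `a` realize `p` and let `d` realize `q` independently from `B` over `A`. The jet `Jet_J(a)` and
`d` have the same `L`-type over `A`, but `d` need not be the jet of a tuple. The idea is to build an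
extension of `𝔐` that contains a copy of `a`, together with all its derivatives, placed as
generically as possible over `𝔐` subject to its jet realizing `q`. On such a copy the derivations
can be prescribed freely.

*Model theory* (`exists_independent_amalgam`, `exists_generic_copy`). An elementary map between
subsets of two models extends to an elementary embedding into an elementary extension that keeps an
`acl`-independent family independent over the whole target model; this is a compactness argument,
carried out with ultraproducts. It gives elementary embeddings `j, g : 𝔐 → N` that agree on `A`,
such that `g(Jet_J(a))` realizes `q` over `j(B)`, and a family `x` of derivatives of `a` that
generates all derivatives of `a` over `A` with respect to `acl` and whose image `g(x)` is
independent over `j(𝔐)`. The hypothesis `q ⊥ B` over `A` is used here: it makes the basis of `d`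
over `A` independent over `B`.

*Algebra* (`exists_derivations_extending`, `exists_extension_with_jet`). By algebraic boundedness
`g(x)` is algebraically independent over the field `j(𝔐)`. In characteristic zero, the derivations
of `j(𝔐)` extend to `N` with arbitrary values on a transcendence basis; they are chosen to satisfy
`Dᵢ(g(x)) = g(δᵢ x)` and to vanish on the rest of the basis. The maps `Dᵢ ∘ g` and `g ∘ δᵢ` are
derivations along `g`, and they agree on `dcl(∅)`, on `A` (as `A` is closed under `δᵢ`) and on `x`.
Hence they agree on everything algebraic over these, in particular on all derivatives of `a`, so
that the jet of `g(a)` is `g(Jet_J(a))`. If the `δᵢ` commute, the commutators of the `Dᵢ` are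
derivations that vanish on `j(𝔐)` and on the transcendence basis, so they vanish.

Thus `N` with the `Dᵢ` is a model of the theory of derivations, and embeds into a model `N'` of its
model completion. By the model completeness of `T`, the embedding is elementary for `L`; the
embedding of `𝔐` is elementary for `L^δ`. The `L^δ`-type over `B` of the image of `g(a)` therefore
is a type of `𝔐` that witnesses the compatibility of `q`, and it is realized in `𝔐` by saturation.
-/

namespace GenericDerivations

/-! ### Formulas with finitely many solutions -/

section TypeEq

variable {L : FirstOrder.Language.{u, u}}

/-- The valuation of `Option I` extending the tuple `c` by the element `y`. -/
def consVal {M : Type u} {I : Type u} (y : M) (c : I → M) : Option I → M :=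
  fun o => o.elim y c

/-- The tuples `v` and `w`, in possibly different structures, satisfy the same formulas. -/
def TypeEq (L : FirstOrder.Language.{u, u}) {M N : Type u} [L.Structure M] [L.Structure N]
    {I : Type*} (v : I → M) (w : I → N) : Prop :=
  ∀ φ : L.Formula I, φ.Realize v ↔ φ.Realize w

variable {M N P : Type u} [L.Structure M] [L.Structure N] [L.Structure P] {I : Type u}

theorem TypeEq.symm {I : Type*} {v : I → M} {w : I → N} (h : TypeEq L v w) : TypeEq L w v :=
  fun φ => (h φ).symm

theorem TypeEq.trans {I : Type*} {v : I → M} {w : I → N} {z : I → P} (h : TypeEq L v w)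
    (h' : TypeEq L w z) : TypeEq L v z :=
  fun φ => (h φ).trans (h' φ)

theorem TypeEq.comp {I J : Type*} {v : I → M} {w : I → N} (h : TypeEq L v w) (f : J → I) :
    TypeEq L (v ∘ f) (w ∘ f) := fun φ => by
  rw [← Formula.realize_relabel, ← Formula.realize_relabel]
  exact h _

theorem typeEq_comp_embedding {I : Type*} (g : M ↪ₑ[L] N) (v : I → M) : TypeEq L v (g ∘ v) :=
  fun φ => (g.map_formula φ v).symm

theorem TypeEq.eq_of_eq {I : Type*} {v : I → M} {w : I → N} (h : TypeEq L v w) {i j : I}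
    (hij : v i = v j) : w i = w j := by
  have := h ((Term.var i).equal (Term.var j))
  simpa [hij] using this

/-- Elementarity may be tested on formulas in arbitrarily many variables, evaluated at the
identity. -/
def embeddingOfTypeEq (g : M → N) (h : TypeEq L (id : M → M) g) : M ↪ₑ[L] N where
  toFun := g
  map_formula' := fun _ φ v => by
    have := (h.comp v) φ
    simpa using this.symm

/-- The formula saying that `φ(·, c)` has at least `r` solutions. -/
noncomputable def atLeast (φ : L.Formula (Option I)) (r : ℕ) : L.Formula I :=
  Formula.iExs (Fin r)
    ((BoundedFormula.iInf fun i : Fin r =>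
        φ.relabel (fun o : Option I => (o.elim (Sum.inr i) Sum.inl : I ⊕ Fin r))) ⊓
      BoundedFormula.iInf fun p : {p : Fin r × Fin r // p.1 ≠ p.2} =>
        ∼ ((Term.var (Sum.inr p.1.1)).equal (Term.var (Sum.inr p.1.2))))

theorem realize_atLeast {φ : L.Formula (Option I)} {r : ℕ} {c : I → M} :
    (atLeast φ r).Realize c ↔
      ∃ z : Fin r → M, Function.Injective z ∧ ∀ i, φ.Realize (consVal (z i) c) := by
  rw [atLeast, Formula.realize_iExs]
  refine exists_congr fun z => ?_
  rw [Formula.realize_inf, and_comm]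
  refine and_congr ?_ ?_
  · rw [Formula.Realize, BoundedFormula.realize_iInf]
    constructor
    · intro h i j hij
      by_contra hne
      have := h ⟨(i, j), hne⟩
      rw [BoundedFormula.realize_not, ← Formula.Realize, Formula.realize_equal] at this
      exact this hij
    · intro h p
      rw [BoundedFormula.realize_not, ← Formula.Realize, Formula.realize_equal]
      exact fun hz => p.2 (h hz)
  · rw [Formula.Realize, BoundedFormula.realize_iInf]
    refine forall_congr' fun i => ?_
    rw [← Formula.Realize, Formula.realize_relabel]
    refine iff_of_eq (congrArg _ (funext fun o => ?_))
    cases o <;> rfl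

theorem realize_atLeast_iff_encard {φ : L.Formula (Option I)} {r : ℕ} {c : I → M} :
    (atLeast φ r).Realize c ↔ (r : ℕ∞) ≤ {y | φ.Realize (consVal y c)}.encard := by
  rw [realize_atLeast]
  constructor
  · rintro ⟨z, hz, h⟩
    have h1 : (Set.range z).encard = r := by
      rw [← Set.image_univ, hz.encard_image]
      simp
    rw [← h1]
    refine Set.encard_le_encard ?_
    rintro _ ⟨i, rfl⟩
    exact h i
  · intro h
    obtain ⟨t, ht, hcard⟩ := Set.exists_subset_encard_eq h
    have hfin : t.Finite := Set.finite_of_encard_eq_coe hcard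
    have := hfin.fintype
    have hc : Fintype.card t = r := by
      have := hcard
      rw [Set.encard_eq_coe_toFinset_card] at this
      rw [← Set.toFinset_card]
      exact_mod_cast this
    let e := (Fintype.equivFinOfCardEq hc).symm
    exact ⟨fun i => e i, Subtype.val_injective.comp e.injective, fun i => ht (e i).2⟩

/-- The number of solutions of `φ(·, c)`, in `ℕ∞`, is determined by the type of `c`. -/
theorem TypeEq.encard_eq {c : I → M} {c' : I → N} (h : TypeEq L c c')
    (φ : L.Formula (Option I)) :
    {y | φ.Realize (consVal y c)}.encard = {y | φ.Realize (consVal y c')}.encard := by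
  refine ENat.eq_of_forall_natCast_le_iff fun r => ?_
  rw [← realize_atLeast_iff_encard, ← realize_atLeast_iff_encard]
  exact h _

theorem TypeEq.finite_iff {c : I → M} {c' : I → N} (h : TypeEq L c c')
    (φ : L.Formula (Option I)) :
    {y | φ.Realize (consVal y c)}.Finite ↔ {y | φ.Realize (consVal y c')}.Finite := by
  rw [← Set.encard_lt_top_iff, ← Set.encard_lt_top_iff, h.encard_eq]

/-! ### The algebraic closure of a tuple -/

theorem mem_acl_range_iff {c : I → M} {x : M} :
    x ∈ acl L (Set.range c) ↔ ∃ φ : L.Formula (Option I),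
      {y | φ.Realize (consVal y c)}.Finite ∧ φ.Realize (consVal x c) := by
  constructor
  · rintro ⟨s, hs, hfin, hx⟩
    rw [Set.Definable₁, Set.definable_iff_exists_formula_sum] at hs
    obtain ⟨φ, hφ⟩ := hs
    let f : Set.range c ⊕ Fin 1 → Option I :=
      Sum.elim (fun a => some (Set.rangeSplitting c a)) fun _ => none
    have key : ∀ y, (φ.relabel f).Realize (consVal y c) ↔ y ∈ s := fun y => by
      rw [Formula.realize_relabel]
      have h1 : (fun _ : Fin 1 => y) ∈ {v : Fin 1 → M | v 0 ∈ s} ↔ y ∈ s := Iff.rfl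
      rw [← h1, hφ, Set.mem_ofPred_eq]
      refine iff_of_eq (congrArg _ (funext fun o => ?_))
      rcases o with a | i
      · exact Set.apply_rangeSplitting c a
      · rfl
    refine ⟨φ.relabel f, ?_, (key x).2 hx⟩
    convert hfin using 1
    ext y
    exact key y
  · rintro ⟨φ, hfin, hx⟩
    refine ⟨_, ?_, hfin, hx⟩
    rw [Set.Definable₁, Set.definable_iff_exists_formula_sum]
    let f : Option I → Set.range c ⊕ Fin 1 :=
      fun o => o.elim (Sum.inr 0) fun i => Sum.inl ⟨c i, i, rfl⟩
    refine ⟨φ.relabel f, ?_⟩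
    ext v
    simp only [Set.mem_ofPred_eq, Formula.realize_relabel]
    refine iff_of_eq (congrArg _ (funext fun o => ?_))
    cases o <;> rfl

theorem TypeEq.mem_acl_iff {c : I → M} {c' : I → N} {x : M} {x' : N}
    (h : TypeEq L (consVal x c) (consVal x' c')) :
    x ∈ acl L (Set.range c) ↔ x' ∈ acl L (Set.range c') := by
  have hc : TypeEq L c c' := h.comp some
  rw [mem_acl_range_iff, mem_acl_range_iff]
  refine exists_congr fun φ => ?_
  rw [hc.finite_iff φ, h φ]

/-- Elementary embeddings preserve and reflect algebraicity. -/
theorem mem_acl_image_iff (g : M ↪ₑ[L] N) {A : Set M} {x : M} :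
    g x ∈ acl L (g '' A) ↔ x ∈ acl L A := by
  have h := (typeEq_comp_embedding g (consVal x (Subtype.val : A → M)))
  have he : g ∘ consVal x (Subtype.val : A → M) = consVal (g x) (g ∘ Subtype.val) := by
    funext o
    cases o <;> rfl
  rw [he] at h
  have := h.mem_acl_iff
  rw [Set.range_comp, Subtype.range_coe] at this
  exact this.symm

theorem acl_mono {A B : Set M} (h : A ⊆ B) : acl L A ⊆ acl L B :=
  fun _ ⟨s, hs, hf, hx⟩ => ⟨s, hs.mono h, hf, hx⟩

theorem subset_acl (A : Set M) : A ⊆ acl L A := fun a ha =>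
  ⟨{a}, Set.Definable.singleton_of_mem L ha, Set.finite_singleton a, rfl⟩

theorem exists_finset_of_mem_acl {A : Set M} {x : M} (h : x ∈ acl L A) :
    ∃ A₀ : Finset M, (A₀ : Set M) ⊆ A ∧ x ∈ acl L (A₀ : Set M) := by
  obtain ⟨s, hs, hf, hx⟩ := h
  obtain ⟨A₀, hA₀, hd⟩ := Set.definable_iff_finitely_definable.1 hs
  exact ⟨A₀, hA₀, s, hd, hf, hx⟩

/-- The finite character of the algebraic closure, for a set `C` together with a family. -/
theorem exists_finset_index_of_mem_acl {X : Type*} {C : Set M} {y : X → M} {S : Set X} {x : M}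
    (h : x ∈ acl L (C ∪ y '' S)) :
    ∃ S₀ : Finset X, (S₀ : Set X) ⊆ S ∧ x ∈ acl L (C ∪ y '' (S₀ : Set X)) := by
  classical
  obtain ⟨A₀, hA₀, hx⟩ := exists_finset_of_mem_acl h
  have hsub : ((A₀.filter (· ∉ C) : Finset M) : Set M) ⊆ y '' S := fun a ha => by
    obtain ⟨ha1, ha2⟩ := Finset.mem_filter.1 ha
    exact (hA₀ ha1).resolve_left ha2
  obtain ⟨S₀, hS₀, he⟩ := Finset.subset_set_image_iff.1 hsub
  refine ⟨S₀, hS₀, acl_mono (fun a ha => ?_) hx⟩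
  by_cases haC : a ∈ C
  · exact Or.inl haC
  · have : a ∈ S₀.image y := he ▸ Finset.mem_filter.2 ⟨ha, haC⟩
    exact Or.inr (by simpa using this)

/-- An elementary submodel is algebraically closed. -/
theorem acl_range_subset (j : M ↪ₑ[L] N) : acl L (Set.range j) ⊆ Set.range j := by
  intro x hx
  obtain ⟨φ, hfin, hφ⟩ := mem_acl_range_iff.1 hx
  have hc : TypeEq L (id : M → M) j := typeEq_comp_embedding j id
  have hcard := hc.encard_eq φ
  have hsub : j '' {y | φ.Realize (consVal y id)} ⊆ {y | φ.Realize (consVal y j)} := by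
    rintro _ ⟨y, hy, rfl⟩
    have := (typeEq_comp_embedding j (consVal y id) φ).1 hy
    have he : j ∘ consVal y id = consVal (j y) j := by
      funext o
      cases o <;> rfl
    rwa [he] at this
  have heq := Set.Finite.eq_of_subset_of_encard_le (hfin.subset hsub) hsub (by
    rw [← hcard, j.injective.encard_image])
  have : x ∈ j '' {y | φ.Realize (consVal y id)} := heq ▸ hφ
  exact Set.image_subset_range _ _ this

end TypeEq

/-! ### Independent amalgamation of elementary maps -/

section Amalgam

variable {L : FirstOrder.Language.{u, u}} {M N : Type u} [L.Structure M] [L.Structure N]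
  {I : Type u}

/-- Any true formula about `M` can be satisfied in `N` compatibly with the given elementary map,
moving a nonalgebraic element outside any finite set: the formula obtained by quantifying out
the remaining variables is satisfied by a nonalgebraic element, so it has infinitely many
solutions. -/
theorem exists_assignment_avoiding {c : I → M} {c' : I → N} (hc : TypeEq L c c') (x : M)
    {φ : L.Formula M} (hφ : φ.Realize id) (E : Finset N) :
    ∃ h : M → N, h ∘ c = c' ∧ φ.Realize h ∧ (x ∉ acl L (Set.range c) → h x ∉ E) := by
  classical
  let V := φ.freeVarFinset
  -- the variable of the new formula that stands for an element of `M`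
  let f : V → Option I ⊕ V := fun m =>
    if hm : (m : M) ∈ Set.range c then Sum.inl (some hm.choose)
    else if (m : M) = x then Sum.inl none else Sum.inr m
  let θ : L.Formula (Option I) :=
    Formula.iExs V (Formula.relabel f (φ.restrictFreeVar id))
  have hθ : θ.Realize (consVal x c) := by
    rw [Formula.realize_iExs]
    refine ⟨Subtype.val, ?_⟩
    rw [Formula.realize_relabel, Formula.Realize,
      BoundedFormula.realize_restrictFreeVar (v' := id)]
    · exact hφ
    · intro m
      simp only [id, Function.comp_apply, f]
      split_ifs with h1 h2
      · exact h1.choose_spec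
      · exact h2.symm
      · rfl
  obtain ⟨y, hy, hyE⟩ : ∃ y, y ∈ {y | θ.Realize (consVal y c')} ∧
      (x ∉ acl L (Set.range c) → y ∉ E) := by
    by_cases hx : x ∈ acl L (Set.range c)
    · have hne : {y | θ.Realize (consVal y c')}.Nonempty := by
        rw [← Set.encard_ne_zero, ← hc.encard_eq θ, Set.encard_ne_zero]
        exact ⟨x, hθ⟩
      exact ⟨hne.some, hne.some_mem, fun h => absurd hx h⟩
    · have hinf : {y | θ.Realize (consVal y c')}.Infinite := fun hfin =>
        hx (mem_acl_range_iff.2 ⟨θ, (hc.finite_iff θ).2 hfin, hθ⟩)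
      obtain ⟨y, hy, hyE⟩ := hinf.exists_notMem_finset E
      exact ⟨y, hy, fun _ => hyE⟩
  rw [Set.mem_ofPred_eq, Formula.realize_iExs] at hy
  obtain ⟨z, hz⟩ := hy
  let h : M → N := fun m =>
    if hm : m ∈ Set.range c then c' hm.choose
    else if m = x then y else if hV : m ∈ V then z ⟨m, hV⟩ else y
  refine ⟨h, funext fun i => ?_, ?_, ?_⟩
  · have hm : c i ∈ Set.range c := ⟨i, rfl⟩
    simp only [Function.comp_apply, h, dif_pos hm]
    exact hc.eq_of_eq hm.choose_spec
  · rw [Formula.realize_relabel, Formula.Realize,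
      BoundedFormula.realize_restrictFreeVar (v' := h)] at hz
    · exact hz
    · intro m
      simp only [id, Function.comp_apply, f, h]
      split_ifs with h1 h2
      · rfl
      · rfl
      · rfl
      · exact absurd m.2 ‹_›
  · intro hx
    have hxc : x ∉ Set.range c := fun h => hx (subset_acl _ h)
    simpa only [h, dif_neg hxc, if_true] using hyE hx

/-- An elementary map from a subset of `M` to `N` extends to an elementary embedding of `M` into
an elementary extension of `N`, moving a given nonalgebraic element outside `N`. The extension
is an ultrapower of `N`. -/
theorem exists_amalgam_avoiding [Nonempty N] {c : I → M} {c' : I → N} (hc : TypeEq L c c') (x : M) :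
    ∃ (N' : Type u) (_ : L.Structure N') (j : N ↪ₑ[L] N') (g : M ↪ₑ[L] N'),
      g ∘ c = j ∘ c' ∧ (x ∉ acl L (Set.range c) → g x ∉ Set.range j) := by
  classical
  -- the finite pieces of the requirements: formulas that `g` has to preserve, and elements of `N`
  -- that `g x` has to avoid
  let Ix := Finset {φ : L.Formula M // φ.Realize id} × Finset N
  have hex : ∀ i : Ix, ∃ h : M → N, h ∘ c = c' ∧ (∀ φ ∈ i.1, φ.1.Realize h) ∧
      (x ∉ acl L (Set.range c) → h x ∉ i.2) := by
    intro i
    let φ : L.Formula M := BoundedFormula.iInf fun φ : i.1 => φ.1.1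
    have hφ : ∀ {Q : Type u} [L.Structure Q] (h : M → Q),
        φ.Realize h ↔ ∀ φ ∈ i.1, φ.1.Realize h := fun h => by
      rw [Formula.Realize, BoundedFormula.realize_iInf]
      exact Subtype.forall
    obtain ⟨h, h1, h2, h3⟩ :=
      exists_assignment_avoiding hc x (φ := φ) ((hφ id).2 fun ψ _ => ψ.2) i.2
    exact ⟨h, h1, (hφ h).1 h2, h3⟩
  choose h h1 h2 h3 using hex
  let U : Ultrafilter Ix := Ultrafilter.of Filter.atTop
  have hU : (U : Filter Ix) ≤ Filter.atTop := Ultrafilter.of_le _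
  let N' := (U : Filter Ix).Product fun _ : Ix => N
  let jf : N → N' := fun y => ((fun _ => y : ∀ _ : Ix, N) : (U : Filter Ix).Product fun _ => N)
  let gf : M → N' := fun m => ((fun i => h i m : ∀ _ : Ix, N) : (U : Filter Ix).Product fun _ => N)
  have hj : TypeEq L (id : N → N) jf := fun φ => by
    have := Ultraproduct.realize_formula_cast (u := U) (M := fun _ : Ix => N) φ
      (fun (y : N) (_ : Ix) => y)
    refine Iff.trans ?_ this.symm
    rw [Filter.eventually_const]
    rfl
  have hg1 : ∀ φ : L.Formula M, φ.Realize id → φ.Realize gf := fun φ hφ => by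
    refine (Ultraproduct.realize_formula_cast (u := U) (M := fun _ : Ix => N) φ
      (fun (m : M) (i : Ix) => h i m)).2 ?_
    filter_upwards [hU (Filter.eventually_ge_atTop (({⟨φ, hφ⟩}, ∅) : Ix))] with i hi
    exact h2 i ⟨φ, hφ⟩ (hi.1 (Finset.mem_singleton_self _))
  have hg : TypeEq L (id : M → M) gf := fun φ =>
    ⟨hg1 φ, fun h => by
      by_contra hn
      exact hg1 φ.not hn h⟩
  refine ⟨N', inferInstance, embeddingOfTypeEq jf hj, embeddingOfTypeEq gf hg, ?_, ?_⟩
  · funext i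
    change gf (c i) = jf (c' i)
    have : ∀ k : Ix, h k (c i) = c' i := fun k => congrFun (h1 k) i
    simp only [gf, jf, this]
    rfl
  · rintro hx ⟨y, hy⟩
    have hy : jf y = gf x := hy
    have h4 : ∀ᶠ i in (U : Filter Ix), y = h i x := Quotient.exact hy
    have h5 : ∀ᶠ i in (U : Filter Ix), y ≠ h i x := by
      filter_upwards [hU (Filter.eventually_ge_atTop ((∅, {y}) : Ix))] with i hi he
      exact h3 i hx (he ▸ hi.2 (Finset.mem_singleton_self _))
    obtain ⟨i, h6, h7⟩ := (h4.and h5).exists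
    exact h7 h6

variable {X : Type} [LinearOrder X]

/-- Independent amalgamation for a finite subfamily `S`, one member at a time in increasing order:
each step places the next member outside an elementary submodel that contains the preceding
members and the previously constructed extension of `N`. -/
theorem exists_amalgam_finset [Nonempty M] [Nonempty N] {c : I → M} {c' : I → N}
    (hc : TypeEq L c c') {x : X → M}
    (hx : ∀ t, x t ∉ acl L (Set.range c ∪ x '' Set.Iio t)) (S : Finset X) :
    ∃ (N' : Type u) (_ : L.Structure N') (j : N ↪ₑ[L] N') (g : M ↪ₑ[L] N'),
      g ∘ c = j ∘ c' ∧
        ∀ t ∈ S, g (x t) ∉ acl L (Set.range j ∪ (g ∘ x) '' (S ∩ Set.Iio t : Set X)) := by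
  induction S using Finset.induction_on_max with
  | empty =>
    obtain ⟨N', i, j, g, h, -⟩ := exists_amalgam_avoiding hc (Classical.arbitrary M)
    exact ⟨N', i, j, g, h, by simp⟩
  | insert a S ha ih =>
    obtain ⟨N₁, _, j₁, g₁, hg₁, hS⟩ := ih
    have : Nonempty N₁ := ‹Nonempty N›.map j₁
    let c₁ : I ⊕ S → M := Sum.elim c fun t => x t
    have hc₁ : TypeEq L c₁ (g₁ ∘ c₁) := typeEq_comp_embedding g₁ c₁
    obtain ⟨N₂, _, j₂, g₂, hg₂, ha₂⟩ := exists_amalgam_avoiding hc₁ (x a)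
    have hI : ∀ i, g₂ (c i) = j₂ (g₁ (c i)) := fun i => congrFun hg₂ (Sum.inl i)
    have hX : ∀ t ∈ S, g₂ (x t) = j₂ (g₁ (x t)) := fun t ht => congrFun hg₂ (Sum.inr ⟨t, ht⟩)
    refine ⟨N₂, inferInstance, j₂.comp j₁, g₂, ?_, ?_⟩
    · funext i
      have := congrFun hg₁ i
      simp only [Function.comp_apply, ElementaryEmbedding.comp_apply] at this ⊢
      rw [hI, this]
    · intro t ht
      rcases Finset.mem_insert.1 ht with rfl | htS
      · -- the new element lies outside an elementary submodel containing all the other ones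
        have h1 : x t ∉ acl L (Set.range c₁) := fun h => hx t (acl_mono (by
          rw [Set.Sum.elim_range]
          refine Set.union_subset_union_right _ ?_
          rintro _ ⟨s, rfl⟩
          exact ⟨s, ha s s.2, rfl⟩) h)
        refine fun h => ha₂ h1 (acl_range_subset j₂ (acl_mono ?_ h))
        rintro _ (⟨y, rfl⟩ | ⟨s, ⟨hs, hst⟩, rfl⟩)
        · exact ⟨j₁ y, rfl⟩
        · have hsS : s ∈ S := by
            rcases Finset.mem_insert.1 hs with rfl | hs
            · exact absurd hst (lt_irrefl _)
            · exact hs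
          exact ⟨g₁ (x s), (hX s hsS).symm⟩
      · rw [hX t htS]
        have h1 := hS t htS
        rw [← mem_acl_image_iff j₂] at h1
        refine fun h => h1 (acl_mono ?_ h)
        rintro _ (⟨y, rfl⟩ | ⟨s, ⟨hs, hst⟩, rfl⟩)
        · exact ⟨j₁ y, Or.inl ⟨y, rfl⟩, rfl⟩
        · have hsS : s ∈ S := by
            rcases Finset.mem_insert.1 hs with rfl | hs
            · exact absurd (lt_trans (ha t htS) hst) (lt_irrefl _)
            · exact hs
          exact ⟨g₁ (x s), Or.inr ⟨s, ⟨hsS, hst⟩, rfl⟩, (hX s hsS).symm⟩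

/-- Independent amalgamation: an elementary map `c ↦ c'` from a subset of `M` to `N` extends to
an elementary embedding of `M` into an elementary extension of `N` that maps a family independent
over `c` to a family independent over `N`. Independence of a linearly ordered family means that
no member is algebraic over the preceding ones. The extension is an ultraproduct of extensions
that work for finite subfamilies. -/
theorem exists_independent_amalgam [Nonempty M] [Nonempty N] {c : I → M} {c' : I → N}
    (hc : TypeEq L c c') {x : X → M}
    (hx : ∀ t, x t ∉ acl L (Set.range c ∪ x '' Set.Iio t)) :
    ∃ (N' : Type u) (_ : L.Structure N') (j : N ↪ₑ[L] N') (g : M ↪ₑ[L] N'),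
      g ∘ c = j ∘ c' ∧ ∀ t, g (x t) ∉ acl L (Set.range j ∪ (g ∘ x) '' Set.Iio t) := by
  classical
  choose F hF jS gS hgS hS using exists_amalgam_finset hc hx
  have : ∀ S, Nonempty (F S) := fun S => ‹Nonempty N›.map (jS S)
  let U : Ultrafilter (Finset X) := Ultrafilter.of Filter.atTop
  have hU : (U : Filter (Finset X)) ≤ Filter.atTop := Ultrafilter.of_le _
  let jf : N → (U : Filter (Finset X)).Product F := fun y =>
    ((fun S => jS S y : ∀ S, F S) : (U : Filter (Finset X)).Product F)
  let gf : M → (U : Filter (Finset X)).Product F := fun m =>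
    ((fun S => gS S m : ∀ S, F S) : (U : Filter (Finset X)).Product F)
  have hj : TypeEq L (id : N → N) jf := fun φ => by
    refine Iff.trans ?_ (Ultraproduct.realize_formula_cast (u := U) (M := F) φ
      (fun (y : N) (S : Finset X) => jS S y)).symm
    rw [← Filter.eventually_const (f := (U : Filter (Finset X))) (p := φ.Realize id)]
    exact Filter.eventually_congr (Filter.Eventually.of_forall fun S =>
      typeEq_comp_embedding (jS S) id φ)
  have hg : TypeEq L (id : M → M) gf := fun φ => by
    refine Iff.trans ?_ (Ultraproduct.realize_formula_cast (u := U) (M := F) φ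
      (fun (y : M) (S : Finset X) => gS S y)).symm
    rw [← Filter.eventually_const (f := (U : Filter (Finset X))) (p := φ.Realize id)]
    exact Filter.eventually_congr (Filter.Eventually.of_forall fun S =>
      typeEq_comp_embedding (gS S) id φ)
  refine ⟨(U : Filter (Finset X)).Product F, inferInstance, embeddingOfTypeEq jf hj,
    embeddingOfTypeEq gf hg, ?_, ?_⟩
  · funext i
    change gf (c i) = jf (c' i)
    have : ∀ S, gS S (c i) = jS S (c' i) := fun S => congrFun (hgS S) i
    simp only [gf, jf, this]
    rfl
  · intro t ht
    change gf (x t) ∈ acl L (Set.range jf ∪ (gf ∘ x) '' Set.Iio t) at ht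
    obtain ⟨T, hT, ht⟩ := exists_finset_index_of_mem_acl ht
    let d : ∀ S, N ⊕ T → F S := fun S => Sum.elim (jS S) fun s => gS S (x s)
    let dU : N ⊕ T → (U : Filter (Finset X)).Product F :=
      fun k => ((fun S => d S k : ∀ S, F S) : (U : Filter (Finset X)).Product F)
    have hd : Set.range dU = Set.range jf ∪ (gf ∘ x) '' (T : Set X) := by
      have : dU = Sum.elim jf fun s : T => gf (x s) := by
        funext k
        cases k <;> rfl
      rw [this, Set.Sum.elim_range]
      congr 1
      ext y
      simp
    rw [← hd, mem_acl_range_iff] at ht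
    obtain ⟨φ, hfin, hφ⟩ := ht
    -- an algebraic formula comes with a bound on the number of its solutions, and this bound
    -- passes to almost all factors
    obtain ⟨r, hr⟩ : ∃ r : ℕ, ¬ (atLeast φ r).Realize dU := by
      obtain ⟨r, hr⟩ := hfin.exists_encard_eq_coe
      refine ⟨r + 1, ?_⟩
      rw [realize_atLeast_iff_encard, hr]
      exact_mod_cast Nat.not_succ_le_self r
    have h1 : ∀ᶠ S in (U : Filter (Finset X)), ¬ (atLeast φ r).Realize (d S) :=
      (Ultraproduct.realize_formula_cast (u := U) (M := F) (atLeast φ r).not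
        (fun k S => d S k)).1 hr
    have h2 : ∀ᶠ S in (U : Filter (Finset X)), φ.Realize (consVal (gS S (x t)) (d S)) := by
      refine (Ultraproduct.realize_formula_cast (u := U) (M := F) φ
        (fun (o : Option (N ⊕ T)) S => consVal (gS S (x t)) (d S) o)).1 ?_
      refine (iff_of_eq (congrArg φ.Realize (funext fun o => ?_))).1 hφ
      cases o <;> rfl
    obtain ⟨S, ⟨h1, h2⟩, h3⟩ := ((h1.and h2).and
      (hU (Filter.eventually_ge_atTop (insert t T)))).exists
    have h4 : {y | φ.Realize (consVal y (d S))}.Finite := by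
      rw [realize_atLeast_iff_encard, not_le] at h1
      exact Set.encard_lt_top_iff.1 (h1.trans (ENat.natCast_lt_top r))
    refine hS S t (h3 (Finset.mem_insert_self _ _))
      (acl_mono ?_ (mem_acl_range_iff.2 ⟨φ, h4, h2⟩))
    rw [Set.Sum.elim_range]
    refine Set.union_subset_union_right _ ?_
    rintro _ ⟨s, rfl⟩
    exact ⟨s, ⟨h3 (Finset.mem_insert_of_mem s.2), hT s.2⟩, rfl⟩

end Amalgam

/-! ### Algebraic elements and algebraically independent families in fields -/

section Algebraic

variable {N : Type*} [Field N]

theorem isAlgebraic_mono {S T : Subfield N} (h : S ≤ T) {x : N} (hx : IsAlgebraic S x) :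
    IsAlgebraic T x :=
  hx.ringHom_of_comp_eq (Subfield.inclusion h) (RingHom.id N) (Subfield.inclusion h).injective rfl

variable {E : Type*} [Field E] [Algebra E N]

/-- The subfield generated by `E` and `s` is the fraction field of the ring `E[s]`; this lemma and
the next one translate between algebraicity over the two. -/
theorem transcendental_adjoin_of_not_isAlgebraic {s : Set N} {x : N}
    (h : ¬ IsAlgebraic (Subfield.closure (Set.range (algebraMap E N) ∪ s)) x) :
    Transcendental (Algebra.adjoin E s) x := fun hx => h <| by
  have hle : ∀ y ∈ Algebra.adjoin E s, y ∈ Subfield.closure (Set.range (algebraMap E N) ∪ s) :=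
    IntermediateField.algebra_adjoin_le_adjoin E s
  let f : Algebra.adjoin E s →+* Subfield.closure (Set.range (algebraMap E N) ∪ s) :=
    { toFun := fun y => ⟨y, hle y y.2⟩
      map_one' := rfl
      map_mul' := fun _ _ => rfl
      map_zero' := rfl
      map_add' := fun _ _ => rfl }
  exact hx.ringHom_of_comp_eq f (RingHom.id N)
    (fun a b hab => Subtype.ext (congrArg Subtype.val hab :)) rfl

open scoped IntermediateField.algebraAdjoinAdjoin in
theorem not_isAlgebraic_of_transcendental_adjoin {s : Set N} {x : N}
    (h : Transcendental (Algebra.adjoin E s) x) :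
    ¬ IsAlgebraic (Subfield.closure (Set.range (algebraMap E N) ∪ s)) x := fun hx => h <| by
  have h1 : IsAlgebraic (IntermediateField.adjoin E s) x := hx
  exact (IsFractionRing.isAlgebraic_iff (Algebra.adjoin E s) (IntermediateField.adjoin E s) N).2 h1

variable {X : Type*} [LinearOrder X] {x : X → N}

/-- A linearly ordered family is algebraically independent as soon as no member is algebraic over
the preceding ones. -/
theorem algebraicIndependent_of_forall_Iio
    (hx : ∀ t,
      ¬ IsAlgebraic (Subfield.closure (Set.range (algebraMap E N) ∪ x '' Set.Iio t)) (x t)) :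
    AlgebraicIndependent E x := by
  classical
  refine algebraicIndependent_of_finite_type fun s hs => ?_
  obtain ⟨S, rfl⟩ := hs.exists_finset_coe
  change AlgebraicIndepOn E x S
  induction S using Finset.induction_on_max with
  | empty =>
    rw [Finset.coe_empty]
    exact algebraicIndependent_empty_type_iff.2 (algebraMap E N).injective
  | insert a S ha ih =>
    rw [Finset.coe_insert]
    refine (ih S.finite_toSet).insert (transcendental_adjoin_of_not_isAlgebraic fun h => hx a ?_)
    refine isAlgebraic_mono (Subfield.closure_mono (Set.union_subset_union_right _ ?_)) h
    exact Set.image_mono fun s hs => ha s hs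

/-- The exchange property: in a linearly ordered family with no member algebraic over the
preceding ones, no member is algebraic over the other ones. -/
theorem not_isAlgebraic_of_forall_Iio {C : Set N}
    (hx : ∀ t, ¬ IsAlgebraic (Subfield.closure (C ∪ x '' Set.Iio t)) (x t)) {t : X} {S : Set X}
    (ht : t ∉ S) : ¬ IsAlgebraic (Subfield.closure (C ∪ x '' S)) (x t) := by
  have key : ∀ s : Set N, Subfield.closure
      (Set.range (algebraMap (Subfield.closure C) N) ∪ s) = Subfield.closure (C ∪ s) := fun s => by
    have : Set.range (algebraMap (Subfield.closure C) N) = (Subfield.closure C : Set N) :=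
      Subtype.range_coe
    rw [this, Subfield.closure_union, Subfield.closure_eq, ← Subfield.closure_union]
  have h1 : AlgebraicIndependent (Subfield.closure C) x :=
    algebraicIndependent_of_forall_Iio fun t => by
      rw [key]
      exact hx t
  rw [← key]
  exact not_isAlgebraic_of_transcendental_adjoin (h1.transcendental_adjoin ht)

end Algebraic

/-! ### Extending derivations -/

section Derivations

variable {E N : Type*} [Field E] [Field N]

/-- The function `d` is a derivation along the homomorphism `g`, that is, a derivation from `E`
to `N` regarded as an `E`-module through `g`. -/
structure IsDerivationAlong (g : E →+* N) (d : E → N) : Prop where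
  map_add : ∀ a b, d (a + b) = d a + d b
  map_mul : ∀ a b, d (a * b) = g a * d b + g b * d a

namespace IsDerivationAlong

variable {g : E →+* N} {d d' : E → N}

theorem sub (hd : IsDerivationAlong g d) (hd' : IsDerivationAlong g d') :
    IsDerivationAlong g fun a => d a - d' a where
  map_add a b := by rw [hd.map_add, hd'.map_add]; ring
  map_mul a b := by rw [hd.map_mul, hd'.map_mul]; ring

theorem map_zero (hd : IsDerivationAlong g d) : d 0 = 0 := by
  have := hd.map_add 0 0
  simpa using this

theorem map_one (hd : IsDerivationAlong g d) : d 1 = 0 := by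
  have := hd.map_mul 1 1
  simpa using this

theorem map_neg (hd : IsDerivationAlong g d) (a : E) : d (-a) = - d a := by
  have := hd.map_add a (-a)
  rw [add_neg_cancel, hd.map_zero] at this
  exact (neg_eq_of_add_eq_zero_right this.symm).symm

/-- The subfield of constants of a derivation. -/
def constants (hd : IsDerivationAlong g d) : Subfield E where
  carrier := {a | d a = 0}
  zero_mem' := hd.map_zero
  one_mem' := hd.map_one
  add_mem' {a b} ha hb := by
    have ha : d a = 0 := ha
    have hb : d b = 0 := hb
    simp [hd.map_add, ha, hb]
  mul_mem' {a b} ha hb := by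
    have ha : d a = 0 := ha
    have hb : d b = 0 := hb
    simp [hd.map_mul, ha, hb]
  neg_mem' {a} ha := by
    have ha : d a = 0 := ha
    simp [hd.map_neg, ha]
  inv_mem' a ha := by
    have ha : d a = 0 := ha
    by_cases h : a = 0
    · simp [h, hd.map_zero]
    · have := hd.map_mul a a⁻¹
      rw [mul_inv_cancel₀ h, hd.map_one, ha, mul_zero, add_zero] at this
      exact (mul_eq_zero.1 this.symm).resolve_left (by simpa using h)

/-- In characteristic zero an element algebraic over constants is a constant. -/
theorem mem_constants_of_isAlgebraic [CharZero E] (hd : IsDerivationAlong g d) {S : Subfield E}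
    (hS : S ≤ hd.constants) {a : E} (ha : IsAlgebraic S a) : a ∈ hd.constants := by
  let := g.toAlgebra
  have hg : ∀ (e : E) (y : N), e • y = g e * y := fun _ _ => rfl
  let : Module S N := inferInstance
  have hs : ∀ (e : S) (y : N), e • y = g e * y := fun _ _ => rfl
  let D : Derivation S E N := Derivation.mk'
    { toFun := d
      map_add' := hd.map_add
      map_smul' := fun s e => by
        have : d s = 0 := hS s.2
        rw [Subfield.smul_def, smul_eq_mul, hd.map_mul, this, mul_zero, add_zero, RingHom.id_apply,
          hs] }
    fun a b => by
      rw [hg, hg]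
      exact hd.map_mul a b
  have h1 : Polynomial.aeval a (Polynomial.derivative (minpoly S a)) ≠ 0 :=
    (minpoly.irreducible ha.isIntegral).separable.aeval_derivative_ne_zero (minpoly.aeval S a)
  have h2 := D.map_aeval (minpoly S a) a
  rw [minpoly.aeval, _root_.map_zero, hg] at h2
  exact (mul_eq_zero.1 h2.symm).resolve_left (by simpa using h1)

end IsDerivationAlong

/-- A formally smooth algebra lifts along nilpotent extensions. -/
theorem exists_section_of_formallySmooth {S N W : Type*} [CommRing S] [CommRing N] [CommRing W]
    [Algebra S N] [Algebra.FormallySmooth S N] (ψ : S →+* W) (π : W →+* N)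
    (hπ : Function.Surjective π) (hker : IsNilpotent (RingHom.ker π))
    (h : π.comp ψ = algebraMap S N) :
    ∃ f : N →+* W, (∀ a, π (f a) = a) ∧ ∀ s, f (algebraMap S N s) = ψ s := by
  let := ψ.toAlgebra
  let πA : W →ₐ[S] N := { π with commutes' := fun s => congrArg (fun f : S →+* N => f s) h }
  let F : N →ₐ[S] W := Algebra.FormallySmooth.liftOfSurjective (AlgHom.id S N) πA hπ hker
  exact ⟨F, fun a => Algebra.FormallySmooth.liftOfSurjective_apply (AlgHom.id S N) πA hπ hker a,
    F.commutes⟩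

open scoped IntermediateField.algebraAdjoinAdjoin in
/-- In characteristic zero `N` is formally étale over the fraction field of the polynomial ring
generated by a transcendence basis, because it is a separable algebraic extension. -/
theorem formallySmooth_adjoin_of_isTranscendenceBasis [CharZero N] [Algebra E N] {Y : Type*}
    {y : Y → N} (hy : IsTranscendenceBasis E y) :
    Algebra.FormallySmooth (Algebra.adjoin E (Set.range y)) N := by
  let S := Algebra.adjoin E (Set.range y)
  let K := IntermediateField.adjoin E (Set.range y)
  have : Algebra.IsAlgebraic K N := hy.isAlgebraic_field
  have : Algebra.FormallySmooth S K := .of_isLocalization (nonZeroDivisors _)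
  have : Algebra.FormallyEtale K N := Algebra.FormallyEtale.of_isSeparable _ N
  exact .comp S K N

/-- A derivation extends to a field extension of characteristic zero, with arbitrary values on a
transcendence basis. A derivation of `N` is the same as a section of the projection to `N` from the
dual numbers over `N`. The given data define a homomorphism to the dual numbers from the polynomial
ring over the basis, and `N` is formally smooth over that polynomial ring. -/
theorem exists_derivation_of_isTranscendenceBasis [CharZero N] [Algebra E N] {d : E → N}
    (hd : IsDerivationAlong (algebraMap E N) d) {Y : Type*} {y : Y → N}
    (hy : IsTranscendenceBasis E y) (v : Y → N) :
    ∃ D : N → N, IsDerivationAlong (RingHom.id N) D ∧ (∀ e, D (algebraMap E N e) = d e) ∧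
      ∀ t, D (y t) = v t := by
  have := formallySmooth_adjoin_of_isTranscendenceBasis hy
  let φ₀ : E →+* TrivSqZeroExt N N :=
    { toFun := fun e => TrivSqZeroExt.inl (algebraMap E N e) + TrivSqZeroExt.inr (d e)
      map_one' := TrivSqZeroExt.ext (by simp) (by simpa using hd.map_one)
      map_zero' := TrivSqZeroExt.ext (by simp) (by simpa using hd.map_zero)
      map_add' := fun a b => TrivSqZeroExt.ext (by simp) (by simpa using hd.map_add a b)
      map_mul' := fun a b => TrivSqZeroExt.ext (by simp)
        (by simpa [mul_comm] using hd.map_mul a b) }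
  let ψ : MvPolynomial Y E →+* TrivSqZeroExt N N :=
    MvPolynomial.eval₂Hom φ₀ fun t => TrivSqZeroExt.inl (y t) + TrivSqZeroExt.inr (v t)
  let π : TrivSqZeroExt N N →+* N :=
    (TrivSqZeroExt.fstHom ℤ N N : TrivSqZeroExt N N →ₐ[ℤ] N).toRingHom
  have hπ : ∀ w : TrivSqZeroExt N N, π w = w.fst := fun _ => rfl
  have hψ : ∀ p, π (ψ p) = MvPolynomial.aeval y p := fun p => by
    have : π.comp ψ = (MvPolynomial.aeval y : MvPolynomial Y E →ₐ[E] N).toRingHom := by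
      refine MvPolynomial.ringHom_ext (fun e => ?_) fun t => ?_
      · simp [hπ, ψ, φ₀]
      · simp [hπ, ψ]
    exact congrArg (fun f : MvPolynomial Y E →+* N => f p) this
  let e := hy.1.aevalEquiv
  obtain ⟨f, hf1, hf2⟩ := exists_section_of_formallySmooth
    (S := Algebra.adjoin E (Set.range y)) (ψ.comp e.symm.toAlgHom.toRingHom) π
    (fun a => ⟨TrivSqZeroExt.inl a, by simp [hπ]⟩)
    ⟨2, by
      refine le_bot_iff.1 ?_
      rw [pow_two, Ideal.mul_le]
      intro a ha b hb
      have ha : a.fst = 0 := ha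
      have hb : b.fst = 0 := hb
      rw [Ideal.mem_bot]
      exact TrivSqZeroExt.ext (by simp [ha]) (by simp [ha, hb])⟩
    (RingHom.ext fun s => by
      have := hψ (e.symm s)
      rw [← hy.1.algebraMap_aevalEquiv] at this
      simpa [e] using this)
  have hf3 : ∀ p : MvPolynomial Y E, f (MvPolynomial.aeval y p) = ψ p := fun p => by
    have := hf2 (e p)
    rw [hy.1.algebraMap_aevalEquiv] at this
    simpa using this
  have hf1 : ∀ a, (f a).fst = a := hf1
  refine ⟨fun a => (f a).snd, ⟨fun a b => by simp, fun a b => ?_⟩, fun a => ?_, fun t => ?_⟩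
  · rw [_root_.map_mul, TrivSqZeroExt.snd_mul, hf1, hf1]
    simp [mul_comm]
  · change (f _).snd = _
    have := hf3 (MvPolynomial.C a)
    rw [MvPolynomial.aeval_C] at this
    rw [this]
    simp [ψ, φ₀]
  · change (f _).snd = _
    have := hf3 (MvPolynomial.X t)
    rw [MvPolynomial.aeval_X] at this
    rw [this]
    simp [ψ]

/-- Derivations extend simultaneously to a field extension of characteristic zero, with arbitrary
values on an independent family, so that they commute whenever they commute on the base field and on
the family: they are chosen to vanish on the rest of a transcendence basis, and a commutator of
derivations is again a derivation. -/
theorem exists_derivations_extending [CharZero N] (g : E →+* N) {ι : Type*} {d : ι → E → N}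
    (hd : ∀ i, IsDerivationAlong g (d i)) {X : Type*} [LinearOrder X] {x : X → N}
    (hx : ∀ t, ¬ IsAlgebraic (Subfield.closure (Set.range g ∪ x '' Set.Iio t)) (x t))
    (v : ι → X → N) :
    ∃ D : ι → N → N, (∀ i, IsDerivationAlong (RingHom.id N) (D i)) ∧
      (∀ i e, D i (g e) = d i e) ∧ (∀ i t, D i (x t) = v i t) ∧
      ∀ i j, (∀ e, D i (D j (g e)) = D j (D i (g e))) →
        (∀ t, D i (D j (x t)) = D j (D i (x t))) → ∀ a, D i (D j a) = D j (D i a) := by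
  classical
  let := g.toAlgebra
  have hind : AlgebraicIndependent E x := algebraicIndependent_of_forall_Iio hx
  have hinj : Function.Injective x := hind.injective
  obtain ⟨Y, hY, hbasis⟩ := exists_isTranscendenceBasis_superset (R := E) (A := N) hind.coe_range
  let w : ι → Y → N := fun i y => if h : (y : N) ∈ Set.range x then v i h.choose else 0
  have hw : ∀ i t (h : x t ∈ Y), w i ⟨x t, h⟩ = v i t := fun i t h => by
    have hm : x t ∈ Set.range x := ⟨t, rfl⟩
    simp only [w, dif_pos hm]
    rw [hinj hm.choose_spec]
  choose D hD1 hD2 hD3 using fun i => exists_derivation_of_isTranscendenceBasis (hd i) hbasis (w i)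
  have hD0 : ∀ i, ∀ y ∈ Y, y ∉ Set.range x → D i y = 0 := fun i y hy hn => by
    rw [hD3 i ⟨y, hy⟩]
    simp only [w, dif_neg hn]
  refine ⟨D, hD1, hD2, fun i t => by rw [hD3 i ⟨x t, hY ⟨t, rfl⟩⟩, hw], fun i j h1 h2 a => ?_⟩
  -- the commutator is a derivation, so it vanishes if it does on `E` and on the basis
  have hc : IsDerivationAlong (RingHom.id N) fun a => D i (D j a) - D j (D i a) :=
    { map_add := fun a b => by
        simp only [(hD1 _).map_add]
        ring
      map_mul := fun a b => by
        simp only [(hD1 _).map_add, (hD1 _).map_mul, RingHom.id_apply]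
        ring }
  have halg := hbasis.isAlgebraic_field.isAlgebraic a
  rw [Subtype.range_coe] at halg
  refine sub_eq_zero.1 (hc.mem_constants_of_isAlgebraic
    (S := (IntermediateField.adjoin E Y).toSubfield) (Subfield.closure_le.2 ?_) halg)
  rintro _ (⟨e, rfl⟩ | hy)
  · exact sub_eq_zero.2 (h1 e)
  · rename_i y
    by_cases hyx : y ∈ Set.range x
    · obtain ⟨t, rfl⟩ := hyx
      exact sub_eq_zero.2 (h2 t)
    · refine sub_eq_zero.2 ?_
      rw [hD0 i y hy hyx, hD0 j y hy hyx, (hD1 i).map_zero, (hD1 j).map_zero]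

end Derivations

/-! ### Models of the complete theory of a field -/

section FieldModels

variable {L : FirstOrder.Language.{u, u}} (ι : FirstOrder.Language.ring →ᴸ L)
  (K : Type u) [Field K] [FirstOrder.Ring.CompatibleRing K] [L.Structure K] [ι.IsExpansionOn K]

/-- A structure elementarily equivalent to an expansion of a field of characteristic zero is an
expansion of a field of characteristic zero. -/
theorem exists_field_of_model [CharZero K] (M : Type u) [L.Structure M] [M ⊨ L.completeTheory K] :
    ∃ (_ : Field M) (_ : FirstOrder.Ring.CompatibleRing M), ι.IsExpansionOn M ∧ CharZero M := by
  let : FirstOrder.Language.ring.Structure M := ι.reduct M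
  have hι : ι.IsExpansionOn M := LHom.isExpansionOn_reduct ι M
  have hK : K ⊨ ι.onTheory (Theory.fieldOfChar 0) := by
    have : CharP K 0 := inferInstance
    rw [LHom.onTheory_model]
    infer_instance
  have hM : M ⊨ ι.onTheory (Theory.fieldOfChar 0) :=
    (inferInstance : M ⊨ L.completeTheory K).mono (Theory.model_iff_subset_completeTheory.1 hK)
  rw [LHom.onTheory_model] at hM
  have hM' : M ⊨ Theory.field := hM.mono Set.subset_union_left
  let := FirstOrder.Field.fieldOfModelField M
  let := FirstOrder.Field.compatibleRingOfModelField M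
  refine ⟨inferInstance, inferInstance, hι, ?_⟩
  have := FirstOrder.Field.charP_of_model_fieldOfChar 0 M
  exact CharP.charP_to_charZero M

/-- An embedding of structures that expand fields is a field homomorphism. -/
def ringHomOfEmbedding {M N : Type u} [Field M] [FirstOrder.Ring.CompatibleRing M] [L.Structure M]
    [ι.IsExpansionOn M] [Field N] [FirstOrder.Ring.CompatibleRing N] [L.Structure N]
    [ι.IsExpansionOn N] (g : M ↪[L] N) : M →+* N :=
  have hadd : ∀ a b, g (a + b) = g a + g b := fun a b => by
    have := g.map_fun (ι.onFunction FirstOrder.Ring.addFunc) ![a, b]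
    rw [LHom.map_onFunction, LHom.map_onFunction] at this
    simpa using this
  have hmul : ∀ a b, g (a * b) = g a * g b := fun a b => by
    have := g.map_fun (ι.onFunction FirstOrder.Ring.mulFunc) ![a, b]
    rw [LHom.map_onFunction, LHom.map_onFunction] at this
    simpa using this
  have hone : g 1 = 1 := by
    have := g.map_fun (ι.onFunction FirstOrder.Ring.oneFunc) ![]
    rw [LHom.map_onFunction, LHom.map_onFunction] at this
    simpa [Matrix.empty_eq] using this
  { toFun := g
    map_one' := hone
    map_mul' := hmul
    map_add' := hadd
    map_zero' := by simpa using hadd 0 0 }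

variable {K} (hbdd : IsAlgebraicallyBounded ι K)

include hbdd in
/-- The exchange property of `acl` in an algebraically bounded theory: in a linearly ordered family
with no member algebraic over the preceding ones, no member is algebraic over the other ones. -/
theorem notMem_acl_of_forall_Iio [CharZero K] {M : Type u} [L.Structure M] [M ⊨ L.completeTheory K]
    {X : Type*} [LinearOrder X] {x : X → M} {C : Set M}
    (hx : ∀ t, x t ∉ acl L (C ∪ x '' Set.Iio t)) {t : X} {S : Set X} (ht : t ∉ S) :
    x t ∉ acl L (C ∪ x '' S) := by
  obtain ⟨_, _, _, _⟩ := exists_field_of_model ι K M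
  rw [hbdd M, ← Set.union_assoc]
  refine not_isAlgebraic_of_forall_Iio (fun t => ?_) ht
  rw [Set.union_assoc, ← hbdd M]
  exact hx t

end FieldModels

/-! ### Elements definable without parameters -/

section DclEmpty

variable {L : FirstOrder.Language.{u, u}} {M N : Type u} [L.Structure M] [L.Structure N]

theorem mem_dcl_empty_iff {c : M} :
    c ∈ dcl L (∅ : Set M) ↔ ∃ φ : L.Formula (Fin 1), Defines φ c := by
  change Set.Definable _ _ _ ↔ _
  rw [Set.empty_definable_iff]
  refine exists_congr fun φ => ⟨fun h x => ?_, fun h => ?_⟩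
  · have : (fun _ : Fin 1 => x) ∈ {v : Fin 1 → M | v 0 ∈ ({c} : Set M)} ↔ x = c := Iff.rfl
    rw [← this, h]
    rfl
  · ext v
    have hv : v = fun _ => v 0 := funext fun i => by rw [Subsingleton.elim i 0]
    have := h (v 0)
    rw [← hv] at this
    exact this.symm

theorem exists_defines_of_elementarilyEquivalent (h : ∀ σ : L.Sentence, M ⊨ σ ↔ N ⊨ σ)
    {φ : L.Formula (Fin 1)} {c : M} (hφ : Defines φ c) : ∃ c' : N, Defines φ c' := by
  let σ : L.Sentence := Formula.iExsUnique (Fin 1) (φ.relabel (Sum.inr : Fin 1 → Empty ⊕ Fin 1))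
  have hσ : ∀ (Q : Type u) [L.Structure Q], Q ⊨ σ ↔ ∃! z : Fin 1 → Q, φ.Realize z := fun Q _ => by
    rw [Sentence.Realize, Formula.realize_iExsUnique]
    simp only [Formula.realize_relabel, Sum.elim_comp_inr]
  have hM : M ⊨ σ := (hσ M).2 ⟨fun _ => c, (hφ c).2 rfl, fun z hz => funext fun i => by
    have hz' : z = fun _ => z 0 := funext fun i => by rw [Subsingleton.elim i 0]
    rw [hz'] at hz
    rw [Subsingleton.elim i 0]
    exact (hφ (z 0)).1 hz⟩
  obtain ⟨z, hz, huniq⟩ := (hσ N).1 ((h σ).1 hM)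
  refine ⟨z 0, fun y => ⟨fun hy => congrFun (huniq _ hy) 0, ?_⟩⟩
  rintro rfl
  have hz' : (fun _ => z 0) = z := funext fun i => by rw [Subsingleton.elim i 0]
  rw [hz']
  exact hz

theorem Defines.map (g : M ↪ₑ[L] N) {φ : L.Formula (Fin 1)} {c : M} (hφ : Defines φ c) :
    Defines φ (g c) := by
  obtain ⟨c', hc'⟩ := exists_defines_of_elementarilyEquivalent (N := N) g.map_sentence hφ
  have : g c = c' := (hc' (g c)).1 ((g.map_formula φ fun _ => c).2 ((hφ c).2 rfl))
  rwa [this]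

theorem eq_of_mem_dcl_empty (g g' : M ↪ₑ[L] N) {c : M} (hc : c ∈ dcl L (∅ : Set M)) :
    g c = g' c := by
  obtain ⟨φ, hφ⟩ := mem_dcl_empty_iff.1 hc
  exact (hφ.map g' (g c)).1 ((hφ.map g (g c)).2 rfl)

end DclEmpty

/-! ### A generic copy of a tuple -/

section GenericCopy

variable {L : FirstOrder.Language.{u, u}} {M : Type u} [L.Structure M]

/-- The elements of a well-ordered family that are not algebraic over the preceding ones generate
the family. -/
theorem forall_mem_of_notMem_acl {X : Type*} [LinearOrder X] [WellFoundedLT X] {C Z : Set M}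
    {x : X → M} (hC : C ⊆ Z) (hZ : acl L Z ⊆ Z)
    (hx : ∀ t, x t ∉ acl L (C ∪ x '' Set.Iio t) → x t ∈ Z) (t : X) : x t ∈ Z := by
  induction t using WellFoundedLT.induction with
  | ind t ih =>
    by_cases h : x t ∈ acl L (C ∪ x '' Set.Iio t)
    · refine hZ (acl_mono (Set.union_subset hC ?_) h)
      rintro _ ⟨s, hs, rfl⟩
      exact ih s hs
    · exact hx t h

theorem TypeEq.mem_acl_union_iff {N : Type u} [L.Structure N] {I : Type u} {X : Type}
    {c : I → M} {c' : I → N} {x : X → M} {x' : X → N}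
    (h : TypeEq L (Sum.elim c x) (Sum.elim c' x')) (t : X) (S : Set X) :
    x t ∈ acl L (Set.range c ∪ x '' S) ↔ x' t ∈ acl L (Set.range c' ∪ x' '' S) := by
  let f : Option (I ⊕ S) → I ⊕ X := fun o => o.elim (Sum.inr t) (Sum.map id Subtype.val)
  have h1 : ∀ {Q : Type u} (e : I → Q) (y : X → Q),
      Sum.elim e y ∘ f = consVal (y t) (Sum.elim e fun s : S => y s) := fun e y => by
    funext o
    rcases o with _ | _ | _ <;> rfl
  have h2 : ∀ {Q : Type u} (e : I → Q) (y : X → Q),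
      Set.range (Sum.elim e fun s : S => y s) = Set.range e ∪ y '' S := fun e y => by
    rw [Set.Sum.elim_range]
    congr 1
    ext
    simp
  have h3 := h.comp f
  rw [h1, h1] at h3
  have := h3.mem_acl_iff
  rwa [h2, h2] at this

variable (ι : FirstOrder.Language.ring →ᴸ L)
  {K : Type u} [Field K] [CharZero K] [FirstOrder.Ring.CompatibleRing K] [L.Structure K]
  [ι.IsExpansionOn K] (hbdd : IsAlgebraicallyBounded ι K)
  [M ⊨ L.completeTheory K]

include hbdd in
/-- A family independent over `A` stays independent over `B`, if it lies in a set independent from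
`B` over `A`. -/
theorem MIndependent.notMem_acl {A B Y : Set M} (h : MIndependent L Y A B) {X : Type*}
    [LinearOrder X] {x : X → M} (hY : Set.range x ⊆ Y)
    (hx : ∀ t, x t ∉ acl L (A ∪ x '' Set.Iio t)) (t : X) :
    x t ∉ acl L ((A ∪ B) ∪ x '' Set.Iio t) := by
  classical
  intro ht
  obtain ⟨S, hS, ht⟩ := exists_finset_index_of_mem_acl ht
  have hinj : ∀ s s', x s = x s' → s = s' := fun s s' hss => by
    by_contra hne
    refine notMem_acl_of_forall_Iio ι hbdd hx (t := s) (S := {s'}) hne (subset_acl _ (Or.inr ?_))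
    exact ⟨s', rfl, hss.symm⟩
  have hindep : AclIndependent L A (x '' (insert t S : Finset X)) := by
    rintro _ ⟨s, -, rfl⟩ hs
    refine notMem_acl_of_forall_Iio ι hbdd hx (t := s) (S := {s}ᶜ) (fun h => h rfl)
      (acl_mono (Set.union_subset_union_right _ ?_) hs)
    rintro _ ⟨⟨s', -, rfl⟩, hne⟩
    exact ⟨s', fun h => hne (by rw [Set.mem_singleton_iff.1 h]; rfl), rfl⟩
  refine h _ ((Set.image_subset_range _ _).trans hY) ((Finset.finite_toSet _).image _) hindep (x t)
    ⟨t, Finset.mem_insert_self _ _, rfl⟩ (acl_mono (Set.union_subset_union_right _ ?_) ht)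
  rintro _ ⟨s, hs, rfl⟩
  exact ⟨⟨s, Finset.mem_insert_of_mem hs, rfl⟩, fun h => (hS hs).ne (hinj _ _ h)⟩

include hbdd in
/-- Let `u` and `d` be families with the same type over `A`, with `d` independent from `B ⊇ A` over
`A`. In some elementary extension `j` of `M`, there is an elementary copy `g` of `M` over `A` that
maps `u` to a realization of the type of `d` over `B`, so that an independent family `x` generating
`u` and a given family `w` over `A` is mapped to a family independent over `M`. -/
theorem exists_generic_copy [Nonempty M] {A B : Set M} (hAB : A ⊆ B) {J W : Type} {u d : J → M}
    (w : W → M)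
    (hud : TypeEq L (Sum.elim (Subtype.val : A → M) u) (Sum.elim (Subtype.val : A → M) d))
    (hd : MIndependent L (Set.range d) A B) :
    ∃ (N : Type u) (_ : L.Structure N) (j g : M ↪ₑ[L] N) (X : Type) (_ : LinearOrder X) (x : X → M),
      (∀ a ∈ A, g a = j a) ∧
      TypeEq L (Sum.elim (Subtype.val : B → M) d)
        (Sum.elim (j ∘ (Subtype.val : B → M)) (g ∘ u)) ∧
      (∀ t, g (x t) ∉ acl L (Set.range j ∪ (g ∘ x) '' Set.Iio t)) ∧
      Set.range x ⊆ Set.range u ∪ Set.range w ∧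
      ∀ Z : Set M, A ⊆ Z → Set.range x ⊆ Z → acl L Z ⊆ Z → Set.range u ⊆ Z ∧ Set.range w ⊆ Z := by
  obtain ⟨_, _⟩ := exists_wellFoundedLT J
  obtain ⟨_, _⟩ := exists_wellFoundedLT W
  -- the independent subfamilies: `J₀` indexes a basis of `u` over `A`, and `W₁` one of `w` over
  -- `A` and `u`
  let J₀ := {t : J // u t ∉ acl L (A ∪ u '' Set.Iio t)}
  let W₁ := {t : W // w t ∉ acl L ((A ∪ Set.range u) ∪ w '' Set.Iio t)}
  have hJ₀ : ∀ {Q : Type u} (y : J → Q) (t : J₀),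
      (fun s : J₀ => y s) '' Set.Iio t ⊆ y '' Set.Iio (t : J) := by
    rintro Q y t _ ⟨s, hs, rfl⟩
    exact ⟨s, hs, rfl⟩
  have hW₁ : ∀ {Q : Type u} (y : W → Q) (t : W₁),
      (fun s : W₁ => y s) '' Set.Iio t ⊆ y '' Set.Iio (t : W) := by
    rintro Q y t _ ⟨s, hs, rfl⟩
    exact ⟨s, hs, rfl⟩
  have hA : ∀ t : J₀, d t ∉ acl L (A ∪ (fun s : J₀ => d s) '' Set.Iio t) := fun t ht => by
    refine t.2 ?_
    have := hud.mem_acl_union_iff t.1 (Set.Iio t.1)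
    rw [Subtype.range_coe] at this
    exact this.2 (acl_mono (Set.union_subset_union_right _ (hJ₀ d t)) ht)
  have hB : ∀ t : J₀, d t ∉ acl L
      (Set.range (Subtype.val : B → M) ∪ (fun s : J₀ => d s) '' Set.Iio t) := fun t => by
    have := hd.notMem_acl ι hbdd (x := fun s : J₀ => d s)
      (by rintro _ ⟨s, rfl⟩; exact ⟨s, rfl⟩) hA t
    rwa [Set.union_eq_self_of_subset_left hAB, ← Subtype.range_coe (s := B)] at this
  -- a copy of `M` over `B` in which the basis of `d` becomes independent over `M`
  obtain ⟨N₁, _, j₁, g₁, hg₁, hind₁⟩ := exists_independent_amalgam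
    (c := (Subtype.val : B → M)) (c' := (Subtype.val : B → M)) (fun _ => Iff.rfl) hB
  have hgB : ∀ b ∈ B, g₁ b = j₁ b := fun b hb => congrFun hg₁ ⟨b, hb⟩
  have hNe : Nonempty N₁ := ‹Nonempty M›.map j₁
  let c : A ⊕ J → M := Sum.elim Subtype.val u
  let c' : A ⊕ J → N₁ := Sum.elim (j₁ ∘ Subtype.val) (g₁ ∘ d)
  have hc : TypeEq L c c' := by
    have h := hud.trans (typeEq_comp_embedding g₁ (Sum.elim (Subtype.val : A → M) d))
    have he : g₁ ∘ Sum.elim (Subtype.val : A → M) d = c' := by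
      funext k
      rcases k with a | t
      · exact hgB a (hAB a.2)
      · rfl
    rwa [he] at h
  have hW : ∀ t : W₁, w t ∉ acl L (Set.range c ∪ (fun s : W₁ => w s) '' Set.Iio t) := fun t ht => by
    refine t.2 (acl_mono (Set.union_subset_union ?_ (hW₁ w t)) ht)
    rw [Set.Sum.elim_range, Subtype.range_coe]
  -- an embedding of `M` that sends `u` to this copy of `d`, with the basis of `w` independent over
  -- the previous model
  obtain ⟨N₂, _, j₂, g₂, hg₂, hind₂⟩ := exists_independent_amalgam hc hW
  have hgA : ∀ a ∈ A, g₂ a = j₂ (j₁ a) := fun a ha => congrFun hg₂ (Sum.inl ⟨a, ha⟩)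
  have hgu : ∀ t, g₂ (u t) = j₂ (g₁ (d t)) := fun t => congrFun hg₂ (Sum.inr t)
  let x : J₀ ⊕ₗ W₁ → M := fun t => Sum.elim (fun s : J₀ => u s) (fun s : W₁ => w s) (ofLex t)
  refine ⟨N₂, inferInstance, j₂.comp j₁, g₂, J₀ ⊕ₗ W₁, inferInstance, x, hgA, ?_, ?_, ?_, ?_⟩
  · have h := typeEq_comp_embedding (j₂.comp g₁) (Sum.elim (Subtype.val : B → M) d)
    have he : (j₂.comp g₁) ∘ Sum.elim (Subtype.val : B → M) d =
        Sum.elim ((j₂.comp j₁) ∘ (Subtype.val : B → M)) (g₂ ∘ u) := by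
      funext k
      rcases k with b | t
      · exact congrArg j₂ (hgB b b.2)
      · exact (hgu t).symm
    rwa [he] at h
  · intro t ht
    rcases t with s | s
    · change g₂ (u s) ∈ _ at ht
      rw [hgu] at ht
      refine hind₁ s ((mem_acl_image_iff j₂).1 (acl_mono ?_ ht))
      rintro _ (⟨y, rfl⟩ | ⟨r, hr, rfl⟩)
      · exact ⟨j₁ y, Or.inl ⟨y, rfl⟩, rfl⟩
      · rcases r with r | r
        · have hrs : r < s := Sum.Lex.inl_lt_inl_iff.1 hr
          exact ⟨g₁ (d r), Or.inr ⟨r, hrs, rfl⟩, (hgu r).symm⟩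
        · exact absurd hr Sum.Lex.not_inr_lt_inl
    · refine hind₂ s (acl_mono ?_ ht)
      rintro _ (⟨y, rfl⟩ | ⟨r, hr, rfl⟩)
      · exact Or.inl ⟨j₁ y, rfl⟩
      · rcases r with r | r
        · exact Or.inl ⟨g₁ (d r), (hgu r).symm⟩
        · have hrs : r < s := Sum.Lex.inr_lt_inr_iff.1 hr
          exact Or.inr ⟨r, hrs, rfl⟩
  · rintro _ ⟨t | t, rfl⟩
    · exact Or.inl ⟨t, rfl⟩
    · exact Or.inr ⟨t, rfl⟩
  · intro Z hAZ hxZ hZ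
    have hu : ∀ t, u t ∈ Z := forall_mem_of_notMem_acl hAZ hZ fun t ht =>
      hxZ ⟨toLex (Sum.inl ⟨t, ht⟩), rfl⟩
    have hu' : Set.range u ⊆ Z := Set.range_subset_iff.2 hu
    refine ⟨hu', Set.range_subset_iff.2 ?_⟩
    exact forall_mem_of_notMem_acl (Set.union_subset hAZ hu') hZ fun t ht =>
      hxZ ⟨toLex (Sum.inr ⟨t, ht⟩), rfl⟩

end GenericCopy

/-! ### Models of the theory of derivations -/

section DerivModels

variable {L : FirstOrder.Language.{u, u}} {k : ℕ}

theorem realize_univClosure {M : Type u} [L.Structure M] {n : ℕ} (φ : L.Formula (Fin n)) :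
    M ⊨ univClosure φ ↔ ∀ v : Fin n → M, φ.Realize v := by
  rw [Sentence.Realize, univClosure, Formula.realize_iAlls]
  refine forall_congr' fun v => ?_
  rw [Formula.realize_relabel]
  rfl

/-- The interpretation of `δᵢ`. -/
def delta (L : FirstOrder.Language.{u, u}) {M : Type u} [L.Structure M]
    [(derivLanguage k).Structure M] (i : Fin k) (x : M) : M :=
  Structure.funMap (deltaSymb L i) ![x]

/-- The interpretation of the symbols `δᵢ` by given functions. -/
abbrev derivStructure {M : Type u} (D : Fin k → M → M) : (derivLanguage k).Structure M where
  funMap := fun f x => match f with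
    | DerivFunc.delta i => D i (x 0)
  RelMap := fun r => r.elim

section Realize

variable {M : Type u} [L.Structure M] [(derivLanguage k).Structure M] {α : Type*}

theorem realize_deltaTerm (i : Fin k) (t : (withDeriv L k).Term α) (v : α → M) :
    (deltaTerm i t).realize v = delta L i (t.realize v) := by
  rw [deltaTerm, Term.realize_functions_apply₁]
  rfl

theorem realize_jetTerm {n : ℕ} {mode : DerivMode} (f : Gam mode k × Fin n) (a : Fin n → M) :
    (jetTerm L f).realize a = f.1.word.foldr (delta L) (a f.2) := by
  rw [jetTerm]
  induction f.1.word with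
  | nil => rfl
  | cons i l ih => rw [List.foldr_cons, List.foldr_cons, realize_deltaTerm, ih]

variable (ι : FirstOrder.Language.ring →ᴸ L) [Field M] [FirstOrder.Ring.CompatibleRing M]
  [ι.IsExpansionOn M]

theorem realize_addTerm (s t : (withDeriv L k).Term α) (v : α → M) :
    (addTerm ι s t).realize v = s.realize v + t.realize v := by
  rw [addTerm, Term.realize_functions_apply₂, LHom.map_onFunction, LHom.map_onFunction,
    FirstOrder.Ring.CompatibleRing.funMap_add]
  rfl

theorem realize_mulTerm (s t : (withDeriv L k).Term α) (v : α → M) :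
    (mulTerm ι s t).realize v = s.realize v * t.realize v := by
  rw [mulTerm, Term.realize_functions_apply₂, LHom.map_onFunction, LHom.map_onFunction,
    FirstOrder.Ring.CompatibleRing.funMap_mul]
  rfl

theorem realize_additiveAxiom (i : Fin k) :
    M ⊨ additiveAxiom ι i ↔ ∀ x y : M, delta L i (x + y) = delta L i x + delta L i y := by
  rw [additiveAxiom, realize_univClosure]
  simp only [Formula.realize_equal, realize_deltaTerm, realize_addTerm, Term.realize_var]
  exact ⟨fun h x y => h ![x, y], fun h v => h _ _⟩

theorem realize_leibnizAxiom (i : Fin k) :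
    M ⊨ leibnizAxiom ι i ↔
      ∀ x y : M, delta L i (x * y) = x * delta L i y + y * delta L i x := by
  rw [leibnizAxiom, realize_univClosure]
  simp only [Formula.realize_equal, realize_deltaTerm, realize_addTerm, realize_mulTerm,
    Term.realize_var]
  exact ⟨fun h x y => h ![x, y], fun h v => h _ _⟩

omit [Field M] [FirstOrder.Ring.CompatibleRing M] [ι.IsExpansionOn M] in
theorem realize_commuteAxiom (i j : Fin k) :
    M ⊨ commuteAxiom L i j ↔ ∀ x : M, delta L i (delta L j x) = delta L j (delta L i x) := by
  rw [commuteAxiom, realize_univClosure]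
  simp only [Formula.realize_equal, realize_deltaTerm, Term.realize_var]
  exact ⟨fun h x => h ![x], fun h v => h _⟩

omit [Field M] [FirstOrder.Ring.CompatibleRing M] [ι.IsExpansionOn M] in
theorem realize_valueAxiom (i : Fin k) (φ ψ : L.Formula (Fin 1)) :
    M ⊨ valueAxiom i φ ψ ↔
      ∀ x : M, φ.Realize (fun _ => x) → ψ.Realize fun _ => delta L i x := by
  rw [valueAxiom, realize_univClosure]
  have h : ∀ v : Fin 1 → M, v = fun _ => v 0 := fun v =>
    funext fun i => by rw [Subsingleton.elim i 0]
  simp only [Formula.realize_imp, LHom.realize_onFormula]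
  constructor
  · intro H x hx
    have := H (fun _ => x) hx
    rw [Formula.Realize, BoundedFormula.realize_subst, ← Formula.Realize,
      LHom.realize_onFormula] at this
    simpa only [realize_deltaTerm, Term.realize_var] using this
  · intro H v hv
    rw [h v] at hv
    have := H _ hv
    rw [Formula.Realize, BoundedFormula.realize_subst, ← Formula.Realize, LHom.realize_onFormula]
    simpa only [realize_deltaTerm, Term.realize_var] using this

variable (K : Type u) [Field K] [FirstOrder.Ring.CompatibleRing K] [L.Structure K]
  [ι.IsExpansionOn K] (mode : DerivMode) (η : Fin k → Derivation ℤ (dclEmpty ι K) (dclEmpty ι K))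

theorem model_derivTheory_iff :
    M ⊨ derivTheory mode ι K η ↔ M ⊨ L.completeTheory K ∧
      (∀ i : Fin k, IsDerivationAlong (RingHom.id M) (delta L i)) ∧
      (∀ (i : Fin k) (c : dclEmpty ι K) (φ ψ : L.Formula (Fin 1)),
        Defines φ (c : K) → Defines ψ (η i c : K) →
          ∀ x : M, φ.Realize (fun _ => x) → ψ.Realize fun _ => delta L i x) ∧
      (mode = DerivMode.commuting →
        ∀ (i j : Fin k) (x : M), delta L i (delta L j x) = delta L j (delta L i x)) := by
  rw [derivTheory]
  simp only [Theory.model_union_iff, LHom.onTheory_model]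
  constructor
  · rintro ⟨⟨⟨⟨h1, h2⟩, h3⟩, h4⟩, h5⟩
    refine ⟨h1, fun i => ⟨?_, ?_⟩, fun i c φ ψ hφ hψ => ?_, fun hm i j => ?_⟩
    · exact (realize_additiveAxiom ι i).1 (h2.realize_of_mem _ ⟨i, rfl⟩)
    · exact (realize_leibnizAxiom ι i).1 (h3.realize_of_mem _ ⟨i, rfl⟩)
    · exact (realize_valueAxiom i φ ψ).1 (h4.realize_of_mem _ ⟨i, c, φ, ψ, hφ, hψ, rfl⟩)
    · exact (realize_commuteAxiom i j).1 (h5.realize_of_mem _ ⟨hm, i, j, rfl⟩)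
  · rintro ⟨h1, h2, h3, h4⟩
    refine ⟨⟨⟨⟨h1, ⟨?_⟩⟩, ⟨?_⟩⟩, ⟨?_⟩⟩, ⟨?_⟩⟩
    · rintro _ ⟨i, rfl⟩
      exact (realize_additiveAxiom ι i).2 (h2 i).map_add
    · rintro _ ⟨i, rfl⟩
      exact (realize_leibnizAxiom ι i).2 (h2 i).map_mul
    · rintro _ ⟨i, c, φ, ψ, hφ, hψ, rfl⟩
      exact (realize_valueAxiom i φ ψ).2 (h3 i c φ ψ hφ hψ)
    · rintro _ ⟨hm, i, j, rfl⟩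
      exact (realize_commuteAxiom i j).2 (h4 hm i j)

end Realize

end DerivModels

/-! ### Extending the derivations to the generic copy -/

section Extension

variable {L : FirstOrder.Language.{u, u}} {k : ℕ} (ι : FirstOrder.Language.ring →ᴸ L)
  {K : Type u} [Field K] [CharZero K] [FirstOrder.Ring.CompatibleRing K] [L.Structure K]
  [ι.IsExpansionOn K] (hbdd : IsAlgebraicallyBounded ι K)
  (mode : DerivMode) (η : Fin k → Derivation ℤ (dclEmpty ι K) (dclEmpty ι K))
  {M : Type u} [L.Structure M] [(derivLanguage k).Structure M]

omit [CharZero K] in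
/-- The theory of derivations forces `dcl(∅)` to be closed under the derivations: a formula that
defines an element of `dcl(∅)` in `M` defines one in `K` as well, and the values there are those
of `η`. -/
theorem delta_mem_dcl_empty [Field M] [FirstOrder.Ring.CompatibleRing M] [ι.IsExpansionOn M]
    (hM : M ⊨ derivTheory mode ι K η) (i : Fin k) {c : M} (hc : c ∈ dcl L (∅ : Set M)) :
    delta L i c ∈ dcl L (∅ : Set M) := by
  obtain ⟨hT, -, hval, -⟩ := (model_derivTheory_iff ι K mode η).1 hM
  have hMK : ∀ σ : L.Sentence, M ⊨ σ ↔ K ⊨ σ := realize_iff_of_model_completeTheory K M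
  obtain ⟨φ, hφ⟩ := mem_dcl_empty_iff.1 hc
  obtain ⟨c', hc'⟩ := exists_defines_of_elementarilyEquivalent hMK hφ
  let c₀ : dclEmpty ι K := ⟨c', mem_dcl_empty_iff.2 ⟨φ, hc'⟩⟩
  obtain ⟨ψ, hψ⟩ := mem_dcl_empty_iff.1 (η i c₀).2
  obtain ⟨d, hd⟩ := exists_defines_of_elementarilyEquivalent (fun σ => (hMK σ).symm) hψ
  have h1 := hval i c₀ φ ψ hc' hψ c ((hφ c).2 rfl)
  rw [(hd _).1 h1]
  exact mem_dcl_empty_iff.2 ⟨ψ, hd⟩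

include hbdd in
/-- In the situation of the theorem, but before passing to the model completion: some model of the
theory of derivations extends `M`, elementarily for the language `L`, and contains a tuple whose jet
realizes the type of `d` over `B`. -/
theorem exists_extension_with_jet [Nonempty M] (hM : M ⊨ derivTheory mode ι K η) {A B : Set M}
    (hAB : A ⊆ B) (hδA : DeltaClosed L k A) {n : ℕ} (J : Set (Gam mode k × Fin n)) (a : Fin n → M)
    (d : J → M)
    (hd : TypeEq L (Sum.elim (Subtype.val : A → M) (jet (L := L) J a))
      (Sum.elim (Subtype.val : A → M) d))
    (hind : MIndependent L (Set.range d) A B) :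
    ∃ (N : Type u) (_ : L.Structure N) (_ : (derivLanguage k).Structure N)
      (f : M ↪[withDeriv L k] N) (e : Fin n → N), N ⊨ derivTheory mode ι K η ∧
      TypeEq L (Sum.elim (Subtype.val : B → M) d)
        (Sum.elim (f ∘ (Subtype.val : B → M)) (jet (L := L) J e)) := by
  have hT : M ⊨ L.completeTheory K := by
    have h1 := hM.mono (Set.subset_union_left.trans (Set.subset_union_left.trans
      (Set.subset_union_left.trans (Set.subset_union_left))))
    rwa [LHom.onTheory_model] at h1
  -- The family of all words in the derivations applied to `a`. In the commuting case it contains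
  -- more than the full jet, but it is visibly closed under the derivations.
  let w : List (Fin k) × Fin n → M := fun l => l.1.foldr (delta L) (a l.2)
  obtain ⟨N, _, j, g, X, _, x, hgA, htype, hx, hxuw, hspan⟩ :=
    exists_generic_copy ι hbdd hAB w hd hind
  have hTN : N ⊨ L.completeTheory K := (j.theory_model_iff _).1 hT
  obtain ⟨_, _, _, _⟩ := exists_field_of_model ι K M
  obtain ⟨_, _, _, _⟩ := exists_field_of_model ι K N
  obtain ⟨-, hder, hval, hcomm⟩ := (model_derivTheory_iff ι K mode η).1 hM
  let jr : M →+* N := ringHomOfEmbedding ι j.toEmbedding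
  let gr : M →+* N := ringHomOfEmbedding ι g.toEmbedding
  have hjr : ∀ y, jr y = j y := fun _ => rfl
  have hgr : ∀ y, gr y = g y := fun _ => rfl
  have hxw : ∀ t, x t ∈ Set.range w := fun t => by
    rcases hxuw ⟨t, rfl⟩ with ⟨s, hs⟩ | h
    · exact ⟨(s.1.1.word, s.1.2), by rw [← hs]; exact (realize_jetTerm _ _).symm⟩
    · exact h
  -- the derivations of `M` extend to `N`, and act on the independent family as those of `M` do
  obtain ⟨D, hD, hDj, hDx, hDcomm⟩ := exists_derivations_extending jr (x := g ∘ x)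
    (d := fun i y => j (delta L i y))
    (fun i => ⟨fun y z => by rw [(hder i).map_add, ← hjr, jr.map_add]; rfl,
      fun y z => by rw [(hder i).map_mul, ← hjr, jr.map_add, jr.map_mul, jr.map_mul]; rfl⟩)
    (fun t ht => hx t ((hbdd N _ _).2
      (isAlgebraic_mono (Subfield.closure_mono Set.subset_union_right) ht)))
    (fun i t => g (delta L i (x t)))
  have hgδ : ∀ i, IsDerivationAlong gr fun y => g (delta L i y) := fun i =>
    ⟨fun y z => by rw [(hder i).map_add, ← hgr, gr.map_add]; rfl,
      fun y z => by rw [(hder i).map_mul, ← hgr, gr.map_add, gr.map_mul, gr.map_mul]; rfl⟩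
  have hDg : ∀ i, IsDerivationAlong gr fun y => D i (g y) := fun i =>
    ⟨fun y z => by rw [← hgr, gr.map_add, (hD i).map_add]; rfl,
      fun y z => by rw [← hgr, gr.map_mul, (hD i).map_mul]; rfl⟩
  -- the elements at which `g` commutes with the derivations
  let Z : Set M := {y | ∀ i, D i (g y) = g (delta L i y)}
  have hAZ : A ⊆ Z := fun y hy i => by
    have h1 : g (delta L i y) = j (delta L i y) := hgA _ (hδA i y hy)
    rw [hgA y hy, h1]
    exact hDj i y
  have hxZ : Set.range x ⊆ Z := by
    rintro _ ⟨t, rfl⟩ i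
    exact hDx i t
  -- on `M` both sides are derivations along `g` that agree on `dcl(∅)`, so they agree on a set
  -- closed under `acl`
  have hZ : acl L Z ⊆ Z := fun y hy i => by
    rw [hbdd M] at hy
    refine sub_eq_zero.1 (((hDg i).sub (hgδ i)).mem_constants_of_isAlgebraic
      (Subfield.closure_le.2 ?_) hy)
    rintro z (hz | hz)
    · refine sub_eq_zero.2 ?_
      rw [eq_of_mem_dcl_empty g j hz,
        eq_of_mem_dcl_empty g j (delta_mem_dcl_empty ι mode η hM i hz)]
      exact hDj i z
    · exact sub_eq_zero.2 (hz i)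
  have hwZ : ∀ l, w l ∈ Z := Set.range_subset_iff.1 (hspan Z hAZ hxZ hZ).2
  let : (derivLanguage k).Structure N := derivStructure D
  have hDδ : ∀ i (y : N), delta L i y = D i y := fun _ _ => rfl
  have hword : ∀ l m, l.foldr (delta L) (g (a m)) = g (w (l, m)) := fun l m => by
    induction l with
    | nil => rfl
    | cons i l ih =>
      rw [List.foldr_cons, ih, hDδ, hwZ (l, m) i]
      rfl
  have hjet : jet (L := L) J (g ∘ a) = g ∘ jet J a := funext fun s => by
    change (jetTerm L s.1).realize (g ∘ a) = g ((jetTerm L s.1).realize a)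
    rw [realize_jetTerm, realize_jetTerm]
    exact hword _ _
  let f : M ↪[withDeriv L k] N :=
    { toFun := j
      inj' := j.injective
      map_fun' := fun {m} F y => by
        rcases F with F | F
        · exact j.map_fun F y
        · cases F with
          | delta i =>
            have hy : y = ![y 0] := funext fun r => by rw [Subsingleton.elim r 0]; rfl
            rw [hy]
            exact (hDj i (y 0)).symm
      map_rel' := fun {m} R y => by
        rcases R with R | R
        · exact j.map_rel R y
        · exact R.elim }
  refine ⟨N, inferInstance, inferInstance, f, g ∘ a, ?_, ?_⟩
  · refine (model_derivTheory_iff ι K mode η).2 ⟨hTN, hD, fun i c φ ψ hφ hψ y hy => ?_,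
      fun hm i i' => ?_⟩
    · obtain ⟨c', hc'⟩ := exists_defines_of_elementarilyEquivalent
        (fun σ => (realize_iff_of_model_completeTheory K M σ).symm) hφ
      rw [(hc'.map j y).1 hy]
      have h1 := hval i c φ ψ hφ hψ c' ((hc' c').2 rfl)
      have h2 := (j.map_formula ψ fun _ => delta L i c').2 h1
      have h3 : delta L i (j c') = j (delta L i c') := hDj i c'
      rw [h3]
      exact h2
    · refine hDcomm i i' (fun y => ?_) fun t => ?_
      · change D i (D i' (j y)) = D i' (D i (j y))
        have hDj : ∀ i y, D i (j y) = j (delta L i y) := hDj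
        rw [hDj, hDj, hDj, hDj, hcomm hm]
      · obtain ⟨l, hl⟩ := hxw t
        have h1 : ∀ r, delta L r (x t) ∈ Z := fun r => by
          rw [← hl]
          exact hwZ (r :: l.1, l.2)
        change D i (D i' (g (x t))) = D i' (D i (g (x t)))
        rw [hxZ ⟨t, rfl⟩, hxZ ⟨t, rfl⟩, h1 i' i, h1 i i', hcomm hm]
  · rw [hjet]
    exact htype

end Extension

/-! ### Complete types and their realizations -/

section Types

variable {L : FirstOrder.Language.{u, u}} {M : Type u} [L.Structure M]

theorem TypesOver.mem_formulas_iff {A : Set M} {α : Type} {p : TypesOver L A α} {c : α → M}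
    (hc : p.IsRealizedBy c) {φ : L[[A]].Formula α} : φ ∈ p.formulas ↔ φ.Realize c := by
  refine ⟨hc φ, fun h => ?_⟩
  rcases p.mem_or_not_mem (Formula.equivSentence φ) with h1 | h1
  · exact h1
  · have h2 : φ.not ∈ p.formulas := h1
    exact absurd h (hc _ h2)

theorem realize_jetFormula {k n : ℕ} {mode : DerivMode} {A : Type u} {Q : Type u} [L.Structure Q]
    [(derivLanguage k).Structure Q] [(constantsOn A).Structure Q] {J : Set (Gam mode k × Fin n)}
    (φ : L[[A]].Formula J) (c : Fin n → Q) :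
    (jetFormula (k := k) φ).Realize c ↔ φ.Realize (jet (L := L) J c) := by
  rw [jetFormula, Formula.Realize, BoundedFormula.realize_subst, ← Formula.Realize,
    LHom.realize_onFormula]
  simp only [LHom.realize_onTerm]
  rfl

/-- A formula with parameters is evaluated by treating the parameters as additional variables. -/
theorem realize_constantsVarsEquiv_formula {A : Type u} {Q : Type u} [L.Structure Q]
    [(constantsOn A).Structure Q] {α : Type} (φ : L[[A]].Formula α) (v : α → Q) :
    φ.Realize v ↔ Formula.Realize (BoundedFormula.constantsVarsEquiv φ : L.Formula (A ⊕ α))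
      (Sum.elim (fun a => (L.con a : Q)) v) :=
  BoundedFormula.realize_constantsVarsEquiv.symm

end Types

/-- A structure for a sum of languages is given by structures for the two languages. -/
theorem exists_eq_sumStructure {L L' : FirstOrder.Language} {M : Type*}
    (S : (L.sum L').Structure M) :
    ∃ (S₁ : L.Structure M) (S₂ : L'.Structure M), S = @Language.sumStructure L L' M S₁ S₂ := by
  refine ⟨(LHom.sumInl : L →ᴸ L.sum L').reduct M,
    (LHom.sumInr : L' →ᴸ L.sum L').reduct M, ?_⟩
  ext n f x
  · cases f <;> rfl
  · cases f <;> rfl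

end GenericDerivations

theorem mainTheorem7
    -- a model complete, algebraically bounded theory `T`, the complete theory of `K`
    (L : FirstOrder.Language.{u, u}) (ι : FirstOrder.Language.ring →ᴸ L)
    (K : Type u) [Field K] [CharZero K] [FirstOrder.Ring.CompatibleRing K]
    [L.Structure K] [ι.IsExpansionOn K]
    (hbdd : IsAlgebraicallyBounded ι K)
    (hmc : IsModelComplete (L.completeTheory K))
    -- the model completion `Tg` of the theory of `k` (commuting, or arbitrary) derivations
    (mode : DerivMode) (k : ℕ) (η : Fin k → Derivation ℤ (dclEmpty ι K) (dclEmpty ι K))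
    (Tg : (withDeriv L k).Theory) (hTg : IsModelCompletion (derivTheory mode ι K η) Tg)
    -- a monster model `𝔐` of `Tg`; a set is small if its cardinality is less than `κ`
    (𝔐 : Type u) [L.Structure 𝔐] [(derivLanguage k).Structure 𝔐] [𝔐 ⊨ Tg]
    (κ : Cardinal.{u}) (hκ : ℵ₀ + L.card < κ) (hsat : IsSaturated (withDeriv L k) 𝔐 κ)
    -- small sets `A ⊆ B` closed under the derivations
    (A B : Set 𝔐) (hAB : A ⊆ B) (hA : #A < κ) (hB : #B < κ)
    (hδA : DeltaClosed L k A) (hδB : DeltaClosed L k B)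
    -- the types
    (n : ℕ) (p : TypesOver (withDeriv L k) A (Fin n))
    (J : Set (Gam mode k × Fin n)) (q : TypesOver L B J)
    (hq : Extends hAB q (jetType p J)) (hind : q.MIndependent A) :
    IsDeltaCompatible q ∧ ∃ c : Fin n → 𝔐, q.IsRealizedBy (jet (L := L) J c) := by
  obtain ⟨a, ha⟩ := hsat A hA n p
  obtain ⟨d, hd, hind⟩ := hind
  have hM : 𝔐 ⊨ derivTheory mode ι K η := hTg.model_of_model 𝔐
  have hL : ∀ (N : Type u) [L.Structure N] [(derivLanguage k).Structure N],
      N ⊨ derivTheory mode ι K η → N ⊨ L.completeTheory K := fun N _ _ hN => by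
    have h1 := hN.mono (Set.subset_union_left.trans (Set.subset_union_left.trans
      (Set.subset_union_left.trans (Set.subset_union_left))))
    rwa [LHom.onTheory_model] at h1
  have hTM := hL 𝔐 hM
  have hNe : Nonempty 𝔐 := by
    obtain ⟨_, _, _, _⟩ := exists_field_of_model ι K 𝔐
    exact ⟨0⟩
  -- the jet of `a` and `d` have the same type over `A`
  have h1 : ∀ φ : L.Formula (A ⊕ J), φ.Realize (Sum.elim Subtype.val (jet (L := L) J a)) →
      φ.Realize (Sum.elim (Subtype.val : A → 𝔐) d) := fun φ hφ => by
    obtain ⟨φ, rfl⟩ : ∃ φ' : L[[A]].Formula J, BoundedFormula.constantsVarsEquiv φ' = φ :=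
      BoundedFormula.constantsVarsEquiv.surjective φ
    have h1 : φ.Realize (jet (L := L) J a) := (realize_constantsVarsEquiv_formula φ _).2 hφ
    have h2 : φ ∈ jetType p J :=
      (TypesOver.mem_formulas_iff ha).2 ((realize_jetFormula φ a).2 h1)
    have h3 := hd _ (hq φ h2)
    rw [LHom.realize_onFormula] at h3
    exact (realize_constantsVarsEquiv_formula φ _).1 h3
  have hud : TypeEq L (Sum.elim (Subtype.val : A → 𝔐) (jet (L := L) J a))
      (Sum.elim (Subtype.val : A → 𝔐) d) := fun φ =>
    ⟨h1 φ, fun h => by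
      by_contra hn
      exact h1 φ.not hn h⟩
  obtain ⟨N, _, _, f, e, hN, hfe⟩ :=
    exists_extension_with_jet ι hbdd mode η hM hAB hδA J a d hud hind
  obtain ⟨N', S, hN', ⟨f'⟩⟩ := hTg.exists_embedding N
  obtain ⟨_, _, rfl⟩ := exists_eq_sumStructure S
  have hTN := hL N hN
  have hTN' := hL N' (hTg.model_of_model N')
  -- by model completeness `N` is an elementary substructure of `N'` for `L`
  let fL : N ↪[L] N' :=
    { toFun := f'
      inj' := f'.injective
      map_fun' := fun F x => f'.map_fun (Sum.inl F) x
      map_rel' := fun R x => f'.map_rel (Sum.inl R) x }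
  let g : N ↪ₑ[L] N' := ⟨f', fun m φ x => hmc N N' fL m φ x⟩
  -- and `𝔐` is one for the language with derivations
  let h : 𝔐 ↪ₑ[withDeriv L k] N' :=
    ⟨f'.comp f, fun m φ x => hTg.realize_iff 𝔐 N' 𝔐 (f'.comp f) (Embedding.refl _ _) m φ x⟩
  let : (constantsOn B).Structure N' := constantsOn.structure fun b => h b
  have htype : ∀ φ : L[[B]].Formula J, φ ∈ q.formulas ↔ φ.Realize (jet (L := L) J (f' ∘ e)) := by
    intro φ
    rw [TypesOver.mem_formulas_iff hd, realize_constantsVarsEquiv_formula,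
      realize_constantsVarsEquiv_formula]
    have h1 := hfe.trans (typeEq_comp_embedding g _)
    have h2 : g ∘ Sum.elim (f ∘ (Subtype.val : B → 𝔐)) (jet (L := L) J e) =
        Sum.elim (fun b : B => (L.con b : N')) (jet (L := L) J (f' ∘ e)) := by
      funext t
      rcases t with b | t
      · rfl
      · exact (HomClass.realize_term f').symm
    rw [h2] at h1
    exact h1 _
  have hNe' : Nonempty N' := ‹Nonempty 𝔐›.map h
  have hcomplete : N' ⊨ ((withDeriv L k)[[B]]).completeTheory 𝔐 :=
    ((h.liftWithConstants B).theory_model_iff _).1 inferInstance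
  -- the type over `B` of the tuple in `N'` is realized in `𝔐` by saturation
  let s : TypesOver (withDeriv L k) B (Fin n) :=
    Theory.typeOf (((withDeriv L k)[[B]]).completeTheory 𝔐) (f' ∘ e)
  have hs : ∀ φ : (withDeriv L k)[[B]].Formula (Fin n), φ ∈ s.formulas ↔ φ.Realize (f' ∘ e) :=
    fun φ =>
    Theory.CompleteType.formula_mem_typeOf
      (T := ((withDeriv L k)[[B]]).completeTheory 𝔐)
  have hqs : q.formulas = jetType s J := Set.ext fun φ => by
    rw [htype, ← realize_jetFormula, ← hs]
    rfl
  obtain ⟨c, hc⟩ := hsat B hB n s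
  refine ⟨⟨s, hqs⟩, c, fun φ hφ => ?_⟩
  rw [hqs] at hφ
  exact (realize_jetFormula φ c).1 (hc _ hφ)
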